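/- **List Update with Delays.** A list of $n$ elements with a given initial order is shared by all algorithms as the starting list. An input $\sigma$ consists of finitely many requests $r_1,\dots,r_m$; request $r_k$ asks for an element $e_k$, arrives at a time $a_k\ge 0$, and has an arbitrary non-negative, monotone non-decreasing delay function ($d_k(t)$ is the delay incurred by $r_k$ if it is unserved up to time $t$, with $d_k(t)=0$ for $t<a_k$; jumps are allowed). At any time a solution may, instantaneously, swap two consecutive elements of its list at cost $1$, or access the first $p$ elements at cost $p$, which serves all arrived, unserved requests for these elements. Its cost is the sum of its access costs, its number of swaps, and the delays incurred by all requests: $d_k(s)$ if $r_k$ is served at time $s$, and $\sup_t d_k(t)$ if it is never served. $OPT(\sigma)$ is the infimum of the costs of all (offline) solutions. **The algorithm.** It keeps a request counter $RC_k$ for every arrived request and an element counter $EC_e$ for every element, all initialized to $0$. While $r_k$ is unserved, $RC_k$ and $EC_{e_k}$ increase by the delay that $r_k$ incurs. * A *prefix-request-counters event on $\ell\in\{1,\dots,n\}$* takes place when the sum of the request counters of the requests for the first $\ell$ elements of the list reaches $\ell$. The algorithm then accesses the first $\min(2\ell,n)$ elements and deletes the request counters of the requests for the first $\ell$ elements.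 * An *element-counter event on $e$* takes place when $EC_e$ reaches the current position $\ell$ of $e$. The algorithm then accesses the first $\min(2\ell,n)$ elements, deletes the request counters of all requests for $e$, sets $EC_e$ to $0$ and moves $e$ to the front with $\ell-1$ swaps. Simultaneous events are handled in an arbitrary order. A jump of a delay function is passed through continuously in an instant: time is replaced by a finer time axis on which the clock stands still while the jumps at that clock time are traversed continuously and monotonically (in an arbitrary manner when several occur at once), with all requests arriving at that clock time arriving before the jumps. The algorithm acts as soon as a counter reaches its threshold, possibly in the middle of a jump, and then incurs only the part of the jump traversed so far. $ALG(\sigma)$ is the cost of the resulting solution. **Theorem.** The algorithm is well defined on every input (every input has such a continuous traversal, and on each of them the algorithm has a run, with finitely many events), and it is $336$-competitive: for every input $\sigma$, whatever the order of simultaneous events and the way in which jumps are traversed, $$ALG(\sigma)\le 336\cdot OPT(\sigma).$$ -/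

import Mathlib

open scoped ENNReal

noncomputable section

namespace ListUpdate

/-- An input of List Update with Delays: `m` requests to elements of `E`. Request `k` asks for
`elt k`, arrives at time `arr k`, and `delay k t` is the total delay it has incurred if it is still
unserved at time `t`. The delay functions are arbitrary nonnegative nondecreasing functions: they
may jump (also at the arrival time) and need not be one-sided continuous. -/
structure Input (E : Type*) (m : ℕ) where
  elt : Fin m → E
  arr : Fin m → ℝ
  delay : Fin m → ℝ → ℝ
  arr_nonneg : ∀ k, 0 ≤ arr k
  delay_nonneg : ∀ k t, 0 ≤ delay k t
  delay_mono : ∀ k, Monotone (delay k)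
  delay_before : ∀ k t, t < arr k → delay k t = 0

/-- The two instantaneous operations on a list. `access p` serves all active requests for the
first `p` elements; `swap i` exchanges the consecutive elements at the (zero-based) positions `i`
and `i + 1`. -/
inductive Action where
  | access (p : ℕ)
  | swap (i : ℕ)

/-- Accessing the first `p` elements costs the position `p` of the farthest of them; a swap of two
consecutive elements costs `1`. -/
def Action.cost : Action → ℕ
  | .access p => p
  | .swap _ => 1

/-- The current list (`pos e` is the zero-based position of `e`) and, for every request, the time
at which it was served, if it was. -/
structure Config (E : Type*) (n m : ℕ) where
  pos : E ≃ Fin n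
  servedAt : Fin m → Option ℝ

variable {E : Type*} {n m : ℕ}

/-- The effect of an action that is performed at time `t`. A swap at a position that has no next
position does nothing. An access serves the requests that have arrived by time `t` and are not yet
served. -/
def Config.step (σ : Input E m) (c : Config E n m) (t : ℝ) : Action → Config E n m
  | .access p =>
      { c with
        servedAt := fun k =>
          if c.servedAt k = none ∧ σ.arr k ≤ t ∧ (c.pos (σ.elt k)).val < p then some t
          else c.servedAt k }
  | .swap i =>
      if h : i + 1 < n then
        { c with pos := c.pos.trans (Equiv.swap ⟨i, Nat.lt_of_succ_lt h⟩ ⟨i + 1, h⟩) }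
      else c

/-- The configuration after the timed actions `acts`, starting from the list `l₀`. -/
def exec (σ : Input E m) (l₀ : E ≃ Fin n) (acts : List (ℝ × Action)) : Config E n m :=
  acts.foldl (fun c a => c.step σ a.1 a.2) ⟨l₀, fun _ => none⟩

/-- The delay paid for request `k`: its total delay at the time of service, and the supremum of its
delay function if it is never served. -/
def Input.delayCost (σ : Input E m) (k : Fin m) : Option ℝ → ℝ≥0∞
  | some t => ENNReal.ofReal (σ.delay k t)
  | none => ⨆ t : ℝ, ENNReal.ofReal (σ.delay k t)

/-- Total cost of a solution: access costs, swaps and delays. -/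
def cost (σ : Input E m) (l₀ : E ≃ Fin n) (acts : List (ℝ × Action)) : ℝ≥0∞ :=
  ((acts.map fun a => a.2.cost).sum : ℕ) + ∑ k, σ.delayCost k ((exec σ l₀ acts).servedAt k)

/-- A (possibly offline) solution: finitely many actions in order of time. -/
def IsSchedule (acts : List (ℝ × Action)) : Prop :=
  (∀ a ∈ acts, 0 ≤ a.1) ∧ acts.Pairwise (fun a b => a.1 ≤ b.1)

/-- The optimal offline cost. -/
def opt (σ : Input E m) (l₀ : E ≃ Fin n) : ℝ≥0∞ :=
  ⨅ (acts : List (ℝ × Action)) (_ : IsSchedule acts), cost σ l₀ acts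

/-- `σ'` is a continuous traversal of `σ`: the same requests on a finer time axis, on which every
jump of a delay function is passed through continuously. The clock `τ` maps the finer time axis to
the original one and stands still while jumps are traversed. Every request arrives at the first
instant at which the clock shows its arrival time (so before any jump at that time), and
`σ'.delay k u` lies between the left and the right limit of `σ.delay k` at `τ u`. -/
def Input.Traverses (σ' σ : Input E m) : Prop :=
  ∃ τ : ℝ → ℝ, Monotone τ ∧ Function.Surjective τ ∧ ∀ k,
    σ'.elt k = σ.elt k ∧
    τ (σ'.arr k) = σ.arr k ∧ (∀ u < σ'.arr k, τ u < σ.arr k) ∧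
    Continuous (σ'.delay k) ∧
    (∀ u t, t < τ u → σ.delay k t ≤ σ'.delay k u) ∧
    (∀ u t, τ u < t → σ'.delay k u ≤ σ.delay k t)

/-- State of the online algorithm: the current time, list and service times, the request counters
and the element counters. The counter of a request that has not arrived, or whose counter has been
deleted, is recorded as `0`. -/
structure AlgState (E : Type*) (n m : ℕ) where
  time : ℝ
  cfg : Config E n m
  rc : Fin m → ℝ
  ec : E → ℝ

def AlgState.init (l₀ : E ≃ Fin n) : AlgState E n m :=
  ⟨0, ⟨l₀, fun _ => none⟩, fun _ => 0, fun _ => 0⟩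

/-- The two kinds of events, a prefix-request-counters event on `ℓ` and an element-counter event
on `e`. -/
inductive Event (E : Type*) where
  | prefixEvent (ℓ : ℕ)
  | elementEvent (e : E)

section Algorithm

variable [DecidableEq E]

/-- Let time pass until `u` without any action: the counter of an unserved request, and the counter
of its element, grow by the delay that the request incurs. -/
def AlgState.advance (σ : Input E m) (s : AlgState E n m) (u : ℝ) : AlgState E n m :=
  { s with
    time := u
    rc := fun k =>
      s.rc k + if s.cfg.servedAt k = none then σ.delay k u - σ.delay k s.time else 0
    ec := fun e =>
      s.ec e + ∑ k with σ.elt k = e ∧ s.cfg.servedAt k = none,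
        (σ.delay k u - σ.delay k s.time) }

/-- The event takes place in the current state: the request counters of the first `ℓ` elements sum
up to `ℓ`, respectively the element counter of `e` equals the (one-based) position of `e`. -/
def AlgState.Enabled (σ : Input E m) (s : AlgState E n m) : Event E → Prop
  | .prefixEvent ℓ =>
      1 ≤ ℓ ∧ ℓ ≤ n ∧ ∑ k with (s.cfg.pos (σ.elt k)).val < ℓ, s.rc k = (ℓ : ℝ)
  | .elementEvent e => s.ec e = ((s.cfg.pos e).val : ℝ) + 1

/-- The actions of the algorithm upon an event at (one-based) position `ℓ`: it accesses the first
`2ℓ` elements (all `n` if `2ℓ > n`); upon an element-counter event on `e` it then moves `e` to the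
front by `ℓ - 1` swaps of `e` with its previous element. -/
def AlgState.actions (s : AlgState E n m) : Event E → List Action
  | .prefixEvent ℓ => [.access (min (2 * ℓ) n)]
  | .elementEvent e =>
      .access (min (2 * ((s.cfg.pos e).val + 1)) n) ::
        (List.range (s.cfg.pos e).val).reverse.map .swap

/-- The state after the event: the actions are performed and counters are deleted or zeroed. -/
def AlgState.fire (σ : Input E m) (s : AlgState E n m) (ev : Event E) : AlgState E n m where
  time := s.time
  cfg := (s.actions ev).foldl (fun c a => c.step σ s.time a) s.cfg
  rc := match ev with
    | .prefixEvent ℓ => fun k => if (s.cfg.pos (σ.elt k)).val < ℓ then 0 else s.rc k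
    | .elementEvent e => fun k => if σ.elt k = e then 0 else s.rc k
  ec := match ev with
    | .prefixEvent _ => s.ec
    | .elementEvent e => Function.update s.ec e 0

/-- `IsRunFrom σ s acts`: started in state `s`, the algorithm may perform exactly the timed actions
`acts`. It acts as soon as an event takes place, and it stops when no event ever takes place again.
If several events take place at the same time, they are treated in an arbitrary order. -/
inductive IsRunFrom (σ : Input E m) : AlgState E n m → List (ℝ × Action) → Prop
  | done (s : AlgState E n m)
      (quiet : ∀ u, s.time ≤ u → ∀ ev, ¬ (s.advance σ u).Enabled σ ev) :
      IsRunFrom σ s []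
  | event (s : AlgState E n m) (t : ℝ) (ev : Event E) (rest : List (ℝ × Action))
      (le : s.time ≤ t)
      (quiet : ∀ u, s.time ≤ u → u < t → ∀ ev', ¬ (s.advance σ u).Enabled σ ev')
      (enabled : (s.advance σ t).Enabled σ ev)
      (run : IsRunFrom σ ((s.advance σ t).fire σ ev) rest) :
      IsRunFrom σ s ((((s.advance σ t).actions ev).map fun a => (t, a)) ++ rest)

/-- `acts` is a complete run of the algorithm on an input with continuous delay functions. -/
def IsRun (σ : Input E m) (l₀ : E ≃ Fin n) (acts : List (ℝ × Action)) : Prop :=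
  IsRunFrom σ (AlgState.init l₀) acts

end Algorithm

end ListUpdate

end

/-! Reduction to continuous delays. Measuring time by the clock reading plus the total delay
stretches every jump into an interval, so traversals exist (`Input.exists_traverses`). On any
traversal an offline schedule costs no more if each action is moved to the first instant at which
the clock shows its time (`Input.Traverses.exists_schedule`). With continuous delays no counter can
skip its threshold, so all counters stay below their thresholds (`AlgState.Safe`).

The actions of the algorithm are paid for by its total delay `D`. A unit of delay raises one request
counter and one element counter by one unit. A prefix event on `ℓ` costs at most `2ℓ` and deletes
`ℓ` from the request counters; an element event at position `ℓ` costs at most `3ℓ` and deletes `ℓ`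
from an element counter. Hence the actions cost at most `5D`, and it remains to bound `D`.

When the offline solution accesses `p` elements, each request that it serves is classified. It is
near if the algorithm has not served it and holds it among its first `4p` elements. Near requests
split into dyadic bands of positions in `(L/2, L]`. An event of level at most `L/2` leaves the
positions and counters of the band alone, and an event of higher level serves the whole band; as the
counters of the first `L` elements sum to at most `L`, the band incurs at most `L` more delay
(`AlgState.Band.fire`). All bands together contribute at most `8p`.

The other requests are far. If a far request is unserved by the algorithm, its element `e` is at
least four times as deep as in the offline list; `e` is flagged until its next move to the front,
and `back e` records the offline swaps that spoil this relation. When a flagged `e` moves to the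
front, enough inversions with the offline list disappear. The invariant `Balanced.potential` reads
`D + 2·inversions + 4·Σ back + 3·Σ_{unflagged} ec ≤ 6·swaps + 3·G + Σ ec`, where `G` counts far
requests only with their offline delay. It survives waiting, events and offline actions, and yields
`D ≤ 6·swaps + 24·access + 3·(offline delay)` (`Balanced.incurred_le`). The total cost is thus at
most `6D ≤ 144·OPT`, which is stronger than the stated ratio. -/

namespace ListUpdate

variable {E : Type*} {n m : ℕ}

/-! ### Continuous traversals -/

section Traversal

/-- The clock reading plus the total delay. -/
def Input.total (σ : Input E m) (t : ℝ) : ℝ := t + ∑ k, σ.delay k t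

lemma Input.total_sub (σ : Input E m) {s t : ℝ} (h : s ≤ t) (k : Fin m) :
    t - s + (σ.delay k t - σ.delay k s) ≤ σ.total t - σ.total s := by
  have h1 : σ.delay k t - σ.delay k s ≤ ∑ k, (σ.delay k t - σ.delay k s) :=
    Finset.single_le_sum (f := fun k => σ.delay k t - σ.delay k s)
      (fun k _ => sub_nonneg.2 (σ.delay_mono k h)) (Finset.mem_univ k)
  rw [Finset.sum_sub_distrib] at h1
  unfold Input.total
  linarith

lemma Input.total_strictMono (σ : Input E m) : StrictMono σ.total := fun _ _ h =>
  add_lt_add_of_lt_of_le h (Finset.sum_le_sum fun k _ => σ.delay_mono k h.le)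

lemma Input.self_le_total (σ : Input E m) (t : ℝ) : t ≤ σ.total t :=
  le_add_of_nonneg_right (Finset.sum_nonneg fun k _ => σ.delay_nonneg k t)

/-- The generalized inverse of `Input.total`. -/
noncomputable def Input.clock (σ : Input E m) (u : ℝ) : ℝ := sSup {t | σ.total t ≤ u}

lemma Input.clock_bddAbove (σ : Input E m) (u : ℝ) : BddAbove {t | σ.total t ≤ u} :=
  ⟨u, fun t ht => (σ.self_le_total t).trans ht⟩

lemma Input.clock_nonempty (σ : Input E m) (u : ℝ) : {t | σ.total t ≤ u}.Nonempty := by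
  -- No request has arrived at negative times, so `σ.total` is the identity there.
  refine ⟨min u (-1), ?_⟩
  have : ∑ k, σ.delay k (min u (-1)) = 0 := Finset.sum_eq_zero fun k _ =>
    σ.delay_before k _ (by have := σ.arr_nonneg k; have := min_le_right u (-1); linarith)
  simp [Input.total, this]

lemma Input.total_le_of_lt_clock (σ : Input E m) {t u : ℝ} (h : t < σ.clock u) :
    σ.total t ≤ u := by
  obtain ⟨s, hs, hts⟩ := exists_lt_of_lt_csSup (σ.clock_nonempty u) h
  exact (σ.total_strictMono.monotone hts.le).trans hs

lemma Input.lt_total_of_clock_lt (σ : Input E m) {t u : ℝ} (h : σ.clock u < t) :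
    u < σ.total t := by
  by_contra! h'
  exact absurd (le_csSup (σ.clock_bddAbove u) h') (not_le.2 h)

lemma Input.clock_mono (σ : Input E m) : Monotone σ.clock := fun u v h =>
  csSup_le_csSup (σ.clock_bddAbove v) (σ.clock_nonempty u) fun _ ht => le_trans ht h

lemma Input.clock_total (σ : Input E m) (t : ℝ) : σ.clock (σ.total t) = t := by
  have : {s | σ.total s ≤ σ.total t} = Set.Iic t := by
    ext s; exact σ.total_strictMono.le_iff_le
  rw [Input.clock, this, csSup_Iic]

lemma Input.clock_surjective (σ : Input E m) : Function.Surjective σ.clock :=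
  fun t => ⟨_, σ.clock_total t⟩

lemma Input.clock_le (σ : Input E m) (u : ℝ) : σ.clock u ≤ u :=
  csSup_le (σ.clock_nonempty u) fun t ht => (σ.self_le_total t).trans ht

/-- For a monotone surjection of the line, every value is attained for a first time. -/
lemma exists_first_preimage {τ : ℝ → ℝ} (hm : Monotone τ) (hs : Function.Surjective τ) (t : ℝ) :
    ∃ u, τ u = t ∧ ∀ v < u, τ v < t := by
  have hc : Continuous τ := hm.continuous_of_surjective hs
  obtain ⟨v, hv⟩ := hs (t - 1)
  have hbdd : BddBelow (τ ⁻¹' {t}) := by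
    refine ⟨v, fun u hu => ?_⟩
    by_contra! h
    have := hm h.le
    simp only [Set.mem_preimage, Set.mem_singleton_iff] at hu
    linarith
  have hmem := (isClosed_singleton.preimage hc).csInf_mem (hs t) hbdd
  refine ⟨sInf (τ ⁻¹' {t}), hmem, fun w hw => ?_⟩
  refine lt_of_le_of_ne (hmem ▸ hm hw.le) fun h => ?_
  exact absurd (csInf_le hbdd h) (not_le.2 hw)

/-- The delay of a request on the stretched time axis: the largest nondecreasing `1`-Lipschitz
function which is at most `σ.delay k t` at `σ.total t`. -/
noncomputable def Input.stretch (σ : Input E m) (k : Fin m) (u : ℝ) : ℝ :=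
  ⨅ t, (σ.delay k t + max (u - σ.total t) 0)

lemma Input.stretch_bddBelow (σ : Input E m) (k : Fin m) (u : ℝ) :
    BddBelow (Set.range fun t => σ.delay k t + max (u - σ.total t) 0) := by
  refine ⟨0, ?_⟩
  rintro _ ⟨t, rfl⟩
  exact add_nonneg (σ.delay_nonneg k t) (le_max_right _ _)

lemma Input.stretch_mono (σ : Input E m) (k : Fin m) : Monotone (σ.stretch k) := by
  intro u v h
  refine le_ciInf fun t => (ciInf_le (σ.stretch_bddBelow k u) t).trans ?_
  gcongr

lemma Input.stretch_nonneg (σ : Input E m) (k : Fin m) (u : ℝ) : 0 ≤ σ.stretch k u :=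
  le_ciInf fun t => add_nonneg (σ.delay_nonneg k t) (le_max_right _ _)

lemma Input.stretch_lipschitz (σ : Input E m) (k : Fin m) : LipschitzWith 1 (σ.stretch k) := by
  refine LipschitzWith.of_le_add_mul 1 fun u v => ?_
  rw [NNReal.coe_one, one_mul, ← sub_le_iff_le_add]
  refine le_ciInf fun t => ?_
  rw [sub_le_iff_le_add]
  refine (ciInf_le (σ.stretch_bddBelow k u) t).trans ?_
  have h1 : u - v ≤ dist u v := le_abs_self _
  have h2 : (0 : ℝ) ≤ dist u v := dist_nonneg
  have h3 := le_max_left (v - σ.total t) 0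
  have h4 := le_max_right (v - σ.total t) 0
  have : max (u - σ.total t) 0 ≤ max (v - σ.total t) 0 + dist u v := max_le (by linarith) (by linarith)
  linarith

/-- Between two clock times a single delay grows by no more than `σ.total` does. The Lipschitz
regularization therefore does not lower the values on the range of `σ.total`; it only interpolates
across the gaps left by jumps. -/
lemma Input.stretch_total (σ : Input E m) (k : Fin m) (s : ℝ) :
    σ.stretch k (σ.total s) = σ.delay k s := by
  apply le_antisymm
  · exact (ciInf_le (σ.stretch_bddBelow k (σ.total s)) s).trans (by simp)
  · refine le_ciInf fun t => ?_
    rcases le_total s t with h | h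
    · have := σ.delay_mono k h
      have := le_max_right (σ.total s - σ.total t) 0
      linarith
    · have := σ.total_sub h k
      have := le_max_left (σ.total s - σ.total t) 0
      linarith

theorem Input.exists_traverses (σ : Input E m) : ∃ σ' : Input E m, σ'.Traverses σ := by
  choose a ha hlt using fun k =>
    exists_first_preimage σ.clock_mono σ.clock_surjective (σ.arr k)
  have hup : ∀ k u t, σ.clock u < t → σ.stretch k u ≤ σ.delay k t := fun k u t h =>
    (σ.stretch_mono k (σ.lt_total_of_clock_lt h).le).trans (σ.stretch_total k t).le
  refine ⟨⟨σ.elt, a, σ.stretch, fun k => ?_, σ.stretch_nonneg, σ.stretch_mono,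
    fun k u hu => ?_⟩, σ.clock, σ.clock_mono, σ.clock_surjective, fun k =>
    ⟨rfl, ha k, hlt k, (σ.stretch_lipschitz k).continuous, fun u t h => ?_, hup k⟩⟩
  · exact ((σ.arr_nonneg k).trans (ha k).ge).trans (σ.clock_le _)
  · obtain ⟨t, h1, h2⟩ := exists_between (hlt k u hu)
    exact le_antisymm ((hup k u t h1).trans (σ.delay_before k t h2).le) (σ.stretch_nonneg k u)
  · exact (σ.stretch_total k t).ge.trans (σ.stretch_mono k (σ.total_le_of_lt_clock h))

/-- Every schedule can be carried over to a continuous traversal, at no greater cost. -/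
theorem Input.Traverses.exists_schedule {σ' σ : Input E m} (h : σ'.Traverses σ) (l₀ : E ≃ Fin n)
    {acts : List (ℝ × Action)} (hs : IsSchedule acts) :
    ∃ acts' : List (ℝ × Action), acts'.Pairwise (fun a b => a.1 ≤ b.1) ∧
      cost σ' l₀ acts' ≤ cost σ l₀ acts := by
  obtain ⟨τ, hm, hsurj, hk⟩ := h
  choose v hv hlt using exists_first_preimage hm hsurj
  have vmono : Monotone v := by
    intro s t hst
    by_contra! hc
    have := hlt s _ hc
    rw [hv] at this
    linarith
  have hserved : ∀ (l : List (ℝ × Action)) (c c' : Config E n m), c'.pos = c.pos →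
      (∀ k, c'.servedAt k = (c.servedAt k).map v) →
      ∀ k, ((l.map fun a => (v a.1, a.2)).foldl (fun c a => c.step σ' a.1 a.2) c').servedAt k =
        ((l.foldl (fun c a => c.step σ a.1 a.2) c).servedAt k).map v := by
    intro l
    induction l with
    | nil => intro c c' _ h; simpa using h
    | cons a l ih =>
      intro c c' hp h
      rw [List.map_cons, List.foldl_cons, List.foldl_cons]
      obtain ⟨t, a⟩ := a
      cases a with
      | access p =>
        apply ih
        · exact hp
        · intro k
          -- Both `v t` and `σ'.arr k` are the first instants of their clock times, so an access at
          -- `v t` sees exactly the requests that have arrived by clock time `t`.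
          have harr : σ'.arr k ≤ v t ↔ σ.arr k ≤ t := by
            constructor
            · intro h1
              rw [← hv t, ← (hk k).2.1]
              exact hm h1
            · intro h1
              by_contra! h2
              have := (hk k).2.2.1 _ h2
              rw [hv] at this
              linarith
          simp only [Config.step, hp, h, (hk k).1, harr, Option.map_eq_none_iff]
          split_ifs <;> rfl
      | swap i =>
        apply ih
        · simp only [Config.step]
          split_ifs
          · simp [hp]
          · exact hp
        · intro k
          simp only [Config.step]
          split_ifs <;> exact h k
  refine ⟨acts.map fun a => (v a.1, a.2), ?_, ?_⟩
  · rw [List.pairwise_map]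
    exact hs.2.imp fun h => vmono h
  · unfold cost
    rw [List.map_map]
    refine add_le_add le_rfl (Finset.sum_le_sum fun k _ => ?_)
    rw [exec, hserved acts ⟨l₀, fun _ => none⟩ ⟨l₀, fun _ => none⟩ rfl fun k => rfl]
    change _ ≤ σ.delayCost k ((exec σ l₀ acts).servedAt k)
    rw [exec]
    generalize (acts.foldl (fun (c : Config E n m) a => c.step σ a.1 a.2)
      ⟨l₀, fun _ => none⟩).servedAt k = o
    cases o with
    | none =>
      refine iSup_le fun u => ?_
      exact le_iSup_of_le (τ u + 1)
        (ENNReal.ofReal_le_ofReal ((hk k).2.2.2.2.2 u _ (lt_add_one _)))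
    | some t =>
      refine ENNReal.ofReal_le_ofReal ?_
      -- The traversed delay is controlled by `σ.delay k t` only where the clock is strictly before
      -- `t`; continuity carries the bound to `v t` from the left.
      refine le_of_tendsto (x := nhdsWithin (v t) (Set.Iio (v t)))
        (((hk k).2.2.2.1.tendsto (v t)).mono_left nhdsWithin_le_nhds) ?_
      filter_upwards [self_mem_nhdsWithin] with u hu
      exact (hk k).2.2.2.2.2 u t (hlt t u hu)

end Traversal

/-! ### Lists and inversions -/

lemma Config.step_swap_pos (σ : Input E m) (c : Config E n m) (t : ℝ) {i : ℕ} (h : i + 1 < n)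
    (x : E) : ((c.step σ t (.swap i)).pos x).val =
      if (c.pos x).val = i then i + 1 else if (c.pos x).val = i + 1 then i else (c.pos x).val := by
  simp only [Config.step, dif_pos h, Equiv.trans_apply, Equiv.swap_apply_def, Fin.ext_iff]
  split_ifs <;> rfl

lemma Config.step_swap_servedAt (σ : Input E m) (c : Config E n m) (t : ℝ) (i : ℕ) :
    (c.step σ t (.swap i)).servedAt = c.servedAt := by
  simp only [Config.step]
  split_ifs <;> rfl

/-- Swapping an element with its predecessor until it is the first one. -/
lemma Config.foldl_swap (σ : Input E m) (t : ℝ) (e : E) (p : ℕ) : ∀ c : Config E n m,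
    (c.pos e).val = p →
    let c' := ((List.range p).reverse.map Action.swap).foldl (fun c a => c.step σ t a) c
    c'.servedAt = c.servedAt ∧ (c'.pos e).val = 0 ∧
      ∀ x, x ≠ e → (c'.pos x).val =
        if (c.pos x).val < p then (c.pos x).val + 1 else (c.pos x).val := by
  induction p with
  | zero => intro c h; simp [h]
  | succ p ih =>
    intro c h
    have hn : p + 1 < n := h ▸ (c.pos e).isLt
    have he : ((c.step σ t (.swap p)).pos e).val = p := by
      rw [c.step_swap_pos σ t hn]
      simp [h]
    obtain ⟨h1, h2, h3⟩ := ih _ he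
    rw [List.range_succ, List.reverse_append, List.map_append, List.foldl_append]
    refine ⟨h1.trans (c.step_swap_servedAt σ t p), h2, fun x hx => (h3 x hx).trans ?_⟩
    have hne : (c.pos x).val ≠ p + 1 := fun h' =>
      hx (c.pos.injective (Fin.ext (h'.trans h.symm)))
    rw [c.step_swap_pos σ t hn]
    split_ifs <;> omega

section Inversions

variable [Fintype E]

/-- The number of elements before `e` in the list `p` and after `e` in the list `q`. -/
def invAt (p q : E ≃ Fin n) (e : E) : ℕ :=
  (Finset.univ.filter fun x => (p x).val < (p e).val ∧ (q e).val < (q x).val).card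

/-- The number of pairs of elements that are ordered differently in the two lists. -/
def inversions (p q : E ≃ Fin n) : ℕ := ∑ e, invAt p q e

lemma inversions_self (p : E ≃ Fin n) : inversions p p = 0 := by
  refine Finset.sum_eq_zero fun e _ => ?_
  rw [invAt, Finset.card_eq_zero, Finset.filter_eq_empty_iff]
  intro x _
  omega

lemma card_pos_lt (p : E ≃ Fin n) (e : E) :
    (Finset.univ.filter fun x => (p x).val < (p e).val).card = (p e).val := by
  have : (Finset.univ.filter fun x => (p x).val < (p e).val).map p.toEmbedding =
      Finset.Iio (p e) := by
    ext i
    simp only [Finset.mem_map, Finset.mem_filter, Finset.mem_univ, true_and, Finset.mem_Iio,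
      Equiv.coe_toEmbedding]
    constructor
    · rintro ⟨x, h, rfl⟩
      exact h
    · intro h
      exact ⟨p.symm i, by simpa using h, by simp⟩
  rw [← Finset.card_map p.toEmbedding, this, Fin.card_Iio]

lemma invAt_add (p q : E ≃ Fin n) (e : E) :
    invAt p q e + (Finset.univ.filter fun x => (p x).val < (p e).val ∧
      (q x).val < (q e).val).card = (p e).val := by
  classical
  refine Eq.trans ?_ (card_pos_lt p e)
  rw [invAt, ← Finset.card_union_of_disjoint]
  · congr 1
    ext x
    simp only [Finset.mem_union, Finset.mem_filter, Finset.mem_univ, true_and]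
    constructor
    · rintro (h | h) <;> exact h.1
    · intro h
      have : (q x).val ≠ (q e).val := fun h' => by
        have := q.injective (Fin.ext h')
        subst this
        omega
      omega
  · rw [Finset.disjoint_filter]
    omega

/-- At most `q e` of the elements before `e` in `p` are also before `e` in `q`; the others form
inversions with `e`. -/
lemma le_invAt_add (p q : E ≃ Fin n) (e : E) : (p e).val ≤ invAt p q e + (q e).val := by
  refine (invAt_add p q e).ge.trans (Nat.add_le_add_left ?_ _)
  refine (Finset.card_le_card fun x hx => ?_).trans (card_pos_lt q e).le
  simp only [Finset.mem_filter, Finset.mem_univ, true_and] at hx ⊢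
  exact hx.2

/-- Moving an element to the front. -/
lemma inversions_move_front {p p' : E ≃ Fin n} (q : E ≃ Fin n) {e : E} (he : (p' e).val = 0)
    (hx : ∀ x, x ≠ e →
      (p' x).val = if (p x).val < (p e).val then (p x).val + 1 else (p x).val) :
    inversions p' q + 2 * invAt p q e ≤ inversions p q + (p e).val := by
  classical
  -- The inversions charged to `e` vanish. A new one arises only at some `y` that precedes `e` in
  -- both lists, and `invAt_add` counts those as `p e - invAt p q e`.
  have key : ∀ y, invAt p' q y + (if y = e then invAt p q e else 0) ≤ invAt p q y +
      if (p y).val < (p e).val ∧ (q y).val < (q e).val then 1 else 0 := by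
    intro y
    by_cases hy : y = e
    · subst hy
      have : invAt p' q y = 0 := by
        rw [invAt, Finset.card_eq_zero, Finset.filter_eq_empty_iff]
        intro x _
        omega
      simp [this]
    · rw [if_neg hy, add_zero]
      have hsub : ∀ x, x ≠ e → (p' x).val < (p' y).val → (p x).val < (p y).val := by
        intro x hxe h
        have h1 := hx x hxe
        have h2 := hx y hy
        have h3 : (p y).val ≠ (p e).val := fun h' => hy (p.injective (Fin.ext h'))
        split_ifs at h1 h2 <;> omega
      split_ifs with hc
      · refine (Finset.card_le_card (t := insert e (Finset.univ.filter fun x =>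
          (p x).val < (p y).val ∧ (q y).val < (q x).val)) ?_).trans (Finset.card_insert_le _ _)
        intro x hxm
        simp only [Finset.mem_filter, Finset.mem_univ, true_and, Finset.mem_insert] at hxm ⊢
        by_cases hxe : x = e
        · exact .inl hxe
        · exact .inr ⟨hsub x hxe hxm.1, hxm.2⟩
      · rw [add_zero]
        refine Finset.card_le_card fun x hxm => ?_
        simp only [Finset.mem_filter, Finset.mem_univ, true_and] at hxm ⊢
        refine ⟨?_, hxm.2⟩
        by_cases hxe : x = e
        · subst hxe
          have h3 : (p y).val ≠ (p x).val := fun h' => hy (p.injective (Fin.ext h'))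
          omega
        · exact hsub x hxe hxm.1
  have hsum := Finset.sum_le_sum fun y (_ : y ∈ Finset.univ) => key y
  rw [Finset.sum_add_distrib, Finset.sum_add_distrib, Finset.sum_ite_eq' Finset.univ e,
    if_pos (Finset.mem_univ e), Finset.sum_boole] at hsum
  have := invAt_add p q e
  simp only [Nat.cast_id] at hsum
  unfold inversions
  omega

/-- Swapping two consecutive elements creates at most one inversion. -/
lemma inversions_swap (p : E ≃ Fin n) {q q' : E ≃ Fin n} {i : ℕ} (hi : i + 1 < n)
    (hq : ∀ x, (q' x).val =
      if (q x).val = i then i + 1 else if (q x).val = i + 1 then i else (q x).val) :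
    inversions p q' ≤ inversions p q + 1 := by
  classical
  set a := q.symm ⟨i, by omega⟩ with ha
  set d := q.symm ⟨i + 1, hi⟩ with hd
  have hqa : ∀ x, (q x).val = i ↔ x = a := fun x => by
    rw [ha, Equiv.eq_symm_apply, Fin.ext_iff]
  have hqd : ∀ x, (q x).val = i + 1 ↔ x = d := fun x => by
    rw [hd, Equiv.eq_symm_apply, Fin.ext_iff]
  -- The only pair whose order changes is `a`, `d`; a new inversion is charged to `d`, which moves
  -- forward.
  have key : ∀ y, invAt p q' y ≤ invAt p q y + if y = d then 1 else 0 := by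
    intro y
    have hsub : ∀ x, ¬ (y = d ∧ x = a) → (q' y).val < (q' x).val → (q y).val < (q x).val := by
      intro x hxy h
      have h1 := hq x
      have h2 := hq y
      rw [← hqa, ← hqd] at hxy
      have h3 : (q x).val = (q y).val → (q' x).val = (q' y).val := fun h' => by rw [h1, h2, h']
      split_ifs at h1 h2 <;> omega
    split_ifs with hy
    · refine (Finset.card_le_card (t := insert a (Finset.univ.filter fun x =>
        (p x).val < (p y).val ∧ (q y).val < (q x).val)) ?_).trans (Finset.card_insert_le _ _)
      intro x hxm
      simp only [Finset.mem_filter, Finset.mem_univ, true_and, Finset.mem_insert] at hxm ⊢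
      by_cases hxe : x = a
      · exact .inl hxe
      · exact .inr ⟨hxm.1, hsub x (fun h => hxe h.2) hxm.2⟩
    · refine Finset.card_le_card fun x hxm => ?_
      simp only [Finset.mem_filter, Finset.mem_univ, true_and] at hxm ⊢
      exact ⟨hxm.1, hsub x (fun h => hy h.1) hxm.2⟩
  have hsum := Finset.sum_le_sum fun y (_ : y ∈ Finset.univ) => key y
  rwa [Finset.sum_add_distrib, Finset.sum_ite_eq' Finset.univ d,
    if_pos (Finset.mem_univ d)] at hsum

end Inversions

/-! ### The algorithm: passage of time and events -/

section Steps

variable (σ : Input E m) (s : AlgState E n m)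

/-- The delay incurred by a request so far. -/
def AlgState.incurred (k : Fin m) : ℝ :=
  match s.cfg.servedAt k with
  | some t => σ.delay k t
  | none => σ.delay k s.time

/-- The (one-based) position at which an event takes place. -/
def AlgState.level : Event E → ℕ
  | .prefixEvent ℓ => ℓ
  | .elementEvent e => (s.cfg.pos e).val + 1

variable {σ s}

lemma AlgState.incurred_none {k : Fin m} (h : s.cfg.servedAt k = none) :
    s.incurred σ k = σ.delay k s.time := by
  simp [AlgState.incurred, h]

lemma AlgState.incurred_some {k : Fin m} {t : ℝ} (h : s.cfg.servedAt k = some t) :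
    s.incurred σ k = σ.delay k t := by
  simp [AlgState.incurred, h]

lemma Input.arr_le_of_delay_ne (σ : Input E m) {k : Fin m} {t : ℝ} (h : σ.delay k t ≠ 0) :
    σ.arr k ≤ t := by
  by_contra! h'
  exact h (σ.delay_before k t h')

variable (σ s) [DecidableEq E]

lemma AlgState.incurred_advance (u : ℝ) (k : Fin m) :
    (s.advance σ u).incurred σ k = s.incurred σ k +
      if s.cfg.servedAt k = none then σ.delay k u - σ.delay k s.time else 0 := by
  simp only [AlgState.incurred, AlgState.advance]
  split <;> rename_i h <;> simp [h]

/-- Lets a waiting period of the algorithm be cut at the times of the offline actions. -/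
lemma AlgState.advance_advance (u v : ℝ) :
    (s.advance σ u).advance σ v = s.advance σ v := by
  have h1 : ((s.advance σ u).advance σ v).rc = (s.advance σ v).rc := by
    funext k
    change s.rc k + (if s.cfg.servedAt k = none then σ.delay k u - σ.delay k s.time else 0) +
      (if s.cfg.servedAt k = none then σ.delay k v - σ.delay k u else 0) =
      s.rc k + if s.cfg.servedAt k = none then σ.delay k v - σ.delay k s.time else 0
    split_ifs <;> ring
  have h2 : ((s.advance σ u).advance σ v).ec = (s.advance σ v).ec := by
    funext e
    change s.ec e + ∑ k with σ.elt k = e ∧ s.cfg.servedAt k = none, (σ.delay k u - σ.delay k s.time)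
      + ∑ k with σ.elt k = e ∧ s.cfg.servedAt k = none, (σ.delay k v - σ.delay k u) =
      s.ec e + ∑ k with σ.elt k = e ∧ s.cfg.servedAt k = none, (σ.delay k v - σ.delay k s.time)
    rw [add_assoc, ← Finset.sum_add_distrib]
    simp
  change AlgState.mk v s.cfg ((s.advance σ u).advance σ v).rc ((s.advance σ u).advance σ v).ec = _
  rw [h1, h2]
  rfl

lemma AlgState.advance_self : s.advance σ s.time = s := by
  simp [AlgState.advance]

lemma AlgState.sum_ec_advance [Fintype E] (F : Finset E) (u : ℝ) :
    ∑ e ∈ F, (s.advance σ u).ec e = ∑ e ∈ F, s.ec e +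
      ∑ k with σ.elt k ∈ F, if s.cfg.servedAt k = none then σ.delay k u - σ.delay k s.time else 0 := by
  simp only [AlgState.advance]
  rw [Finset.sum_add_distrib, ← Finset.sum_fiberwise_of_maps_to (s := {k | σ.elt k ∈ F})
    (t := F) (g := σ.elt) (by simp)]
  congr 1
  refine Finset.sum_congr rfl fun e he => ?_
  rw [← Finset.sum_filter]
  refine Finset.sum_congr ?_ fun _ _ => rfl
  ext k
  simp only [Finset.mem_filter, Finset.mem_univ, true_and]
  constructor
  · rintro ⟨rfl, h⟩; exact ⟨⟨he, rfl⟩, h⟩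
  · rintro ⟨⟨_, rfl⟩, h⟩; exact ⟨rfl, h⟩

lemma AlgState.fire_servedAt (ev : Event E) (k : Fin m) :
    (s.fire σ ev).cfg.servedAt k =
      if s.cfg.servedAt k = none ∧ σ.arr k ≤ s.time ∧
        (s.cfg.pos (σ.elt k)).val < min (2 * s.level ev) n then some s.time
      else s.cfg.servedAt k := by
  cases ev with
  | prefixEvent ℓ => rfl
  | elementEvent e =>
    have := (Config.foldl_swap σ s.time e _
      (s.cfg.step σ s.time (.access (min (2 * ((s.cfg.pos e).val + 1)) n))) rfl).1
    exact congrFun this k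

lemma AlgState.fire_pos_element (e : E) :
    ((s.fire σ (.elementEvent e)).cfg.pos e).val = 0 ∧ ∀ x, x ≠ e →
      ((s.fire σ (.elementEvent e)).cfg.pos x).val =
        if (s.cfg.pos x).val < (s.cfg.pos e).val then (s.cfg.pos x).val + 1
        else (s.cfg.pos x).val :=
  (Config.foldl_swap σ s.time e _
    (s.cfg.step σ s.time (.access (min (2 * ((s.cfg.pos e).val + 1)) n))) rfl).2

variable {σ s}

lemma AlgState.fire_pos_eq {ev : Event E} {x : E} (h : s.level ev ≤ (s.cfg.pos x).val) :
    ((s.fire σ ev).cfg.pos x).val = (s.cfg.pos x).val := by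
  cases ev with
  | prefixEvent ℓ => rfl
  | elementEvent e =>
    simp only [AlgState.level] at h
    rw [(s.fire_pos_element σ e).2 x (by rintro rfl; omega), if_neg (by omega)]

lemma AlgState.fire_servedAt_some {ev : Event E} {k : Fin m} {t : ℝ}
    (h : s.cfg.servedAt k = some t) : (s.fire σ ev).cfg.servedAt k = some t := by
  rw [AlgState.fire_servedAt, if_neg (by simp [h]), h]

lemma AlgState.servedAt_none_of_fire {ev : Event E} {k : Fin m}
    (h : (s.fire σ ev).cfg.servedAt k = none) : s.cfg.servedAt k = none := by
  by_contra h'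
  obtain ⟨t, ht⟩ := Option.ne_none_iff_exists'.1 h'
  rw [AlgState.fire_servedAt_some ht] at h
  cases h

/-- An arrived request at a position which is at most twice the level of an event is served. -/
lemma AlgState.fire_served {ev : Event E} {k : Fin m} (ha : σ.arr k ≤ s.time)
    (hp : (s.cfg.pos (σ.elt k)).val < 2 * s.level ev) :
    (s.fire σ ev).cfg.servedAt k ≠ none := by
  rw [AlgState.fire_servedAt]
  split_ifs with h
  · simp
  · intro h'
    exact h ⟨h', ha, lt_min hp (s.cfg.pos _).isLt⟩

lemma AlgState.incurred_fire (ev : Event E) (k : Fin m) :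
    (s.fire σ ev).incurred σ k = s.incurred σ k := by
  have h := s.fire_servedAt σ ev k
  split_ifs at h with hc
  · rw [AlgState.incurred_some h, AlgState.incurred_none hc.1]
  · unfold AlgState.incurred
    rw [h]
    rfl

lemma AlgState.fire_rc_eq (ev : Event E) (k : Fin m) :
    (s.fire σ ev).rc k = 0 ∨ (s.fire σ ev).rc k = s.rc k := by
  cases ev <;> simp only [AlgState.fire] <;> split_ifs <;> simp

/-- An event deletes no request counter beyond its level. -/
lemma AlgState.fire_rc_of_le {ev : Event E} {k : Fin m}
    (h : s.level ev ≤ (s.cfg.pos (σ.elt k)).val) : (s.fire σ ev).rc k = s.rc k := by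
  cases ev with
  | prefixEvent ℓ => exact if_neg (not_lt.2 h)
  | elementEvent e =>
    refine if_neg ?_
    rintro rfl
    simp [AlgState.level] at h

/-- The counter of an unserved request survives an event. -/
lemma AlgState.fire_rc_of_unserved {ev : Event E} {k : Fin m}
    (hrc : s.cfg.servedAt k = none → s.rc k = σ.delay k s.time)
    (h : (s.fire σ ev).cfg.servedAt k = none) :
    (s.fire σ ev).rc k = σ.delay k (s.fire σ ev).time := by
  change _ = σ.delay k s.time
  have h0 := hrc (AlgState.servedAt_none_of_fire h)
  rcases lt_or_ge (s.cfg.pos (σ.elt k)).val (s.level ev) with hl | hl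
  · have : s.time < σ.arr k := by
      by_contra! ha
      exact AlgState.fire_served ha (by omega) h
    rw [σ.delay_before k _ this] at h0 ⊢
    rcases AlgState.fire_rc_eq (σ := σ) (s := s) ev k with h1 | h1 <;> simp [h1, h0]
  · rw [AlgState.fire_rc_of_le hl, h0]

end Steps

/-! ### Existence of runs -/

section Runs

variable {σ : Input E m}

lemma Input.delay_of_le_arr (hc : ∀ k, Continuous (σ.delay k)) {k : Fin m} {t : ℝ}
    (h : t ≤ σ.arr k) : σ.delay k t = 0 := by
  refine le_antisymm ((σ.delay_mono k h).trans ?_) (σ.delay_nonneg k t)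
  refine le_of_tendsto (x := nhdsWithin (σ.arr k) (Set.Iio (σ.arr k)))
    (((hc k).tendsto (σ.arr k)).mono_left nhdsWithin_le_nhds) ?_
  filter_upwards [self_mem_nhdsWithin] with u hu
  exact (σ.delay_before k u hu).le

variable {s : AlgState E n m}

/-- The counters of the state account for the delays of the unserved requests. -/
structure AlgState.Consistent (σ : Input E m) (s : AlgState E n m) : Prop where
  rc_eq : ∀ k, s.cfg.servedAt k = none → s.rc k = σ.delay k s.time
  le_ec : ∀ k, s.cfg.servedAt k = none → σ.delay k s.time ≤ s.ec (σ.elt k)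

lemma AlgState.Consistent.init (hc : ∀ k, Continuous (σ.delay k)) (l₀ : E ≃ Fin n) :
    (AlgState.init l₀ : AlgState E n m).Consistent σ where
  rc_eq k _ := (σ.delay_of_le_arr hc (σ.arr_nonneg k)).symm
  le_ec k _ := (σ.delay_of_le_arr hc (σ.arr_nonneg k)).le

variable [DecidableEq E]

lemma AlgState.continuous_rc_advance (hc : ∀ k, Continuous (σ.delay k)) (s : AlgState E n m)
    (k : Fin m) : Continuous fun u => (s.advance σ u).rc k := by
  simp only [AlgState.advance]
  have := hc k
  split_ifs <;> fun_prop

lemma AlgState.continuous_ec_advance (hc : ∀ k, Continuous (σ.delay k)) (s : AlgState E n m)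
    (e : E) : Continuous fun u => (s.advance σ u).ec e := by
  simp only [AlgState.advance]
  fun_prop

lemma AlgState.isClosed_enabled (hc : ∀ k, Continuous (σ.delay k)) (s : AlgState E n m)
    (ev : Event E) : IsClosed {u | (s.advance σ u).Enabled σ ev} := by
  cases ev with
  | prefixEvent ℓ =>
    simp only [AlgState.Enabled]
    refine isClosed_const.and (isClosed_const.and (isClosed_eq ?_ continuous_const))
    exact continuous_finsetSum (Finset.univ.filter fun k => (s.cfg.pos (σ.elt k)).val < ℓ)
      fun k _ => s.continuous_rc_advance hc k
  | elementEvent e =>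
    exact isClosed_eq (s.continuous_ec_advance hc e)
      (continuous_const (y := ((s.cfg.pos e).val : ℝ) + 1))

/-- If an event ever takes place, then there is a first moment at which one does. -/
lemma AlgState.exists_first_event [Finite E] (hc : ∀ k, Continuous (σ.delay k))
    (s : AlgState E n m) (h : ∃ u, s.time ≤ u ∧ ∃ ev, (s.advance σ u).Enabled σ ev) :
    ∃ t ev, s.time ≤ t ∧ (s.advance σ t).Enabled σ ev ∧
      ∀ u, s.time ≤ u → u < t → ∀ ev', ¬ (s.advance σ u).Enabled σ ev' := by
  set T := {u | s.time ≤ u ∧ ∃ ev, (s.advance σ u).Enabled σ ev} with hT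
  have hcl : IsClosed T := by
    have : T = Set.Ici s.time ∩ ((⋃ ℓ ∈ Set.Iic n, {u | (s.advance σ u).Enabled σ (.prefixEvent ℓ)}) ∪
        ⋃ e, {u | (s.advance σ u).Enabled σ (.elementEvent e)}) := by
      ext u
      simp only [hT, Set.mem_ofPred_eq, Set.mem_inter_iff, Set.mem_Ici, Set.mem_union,
        Set.mem_iUnion, Set.mem_Iic, exists_prop]
      refine and_congr_right fun _ => ?_
      constructor
      · rintro ⟨ℓ | e, hev⟩
        · exact .inl ⟨ℓ, hev.2.1, hev⟩
        · exact .inr ⟨e, hev⟩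
      · rintro (⟨ℓ, _, hev⟩ | ⟨e, hev⟩)
        exacts [⟨_, hev⟩, ⟨_, hev⟩]
    rw [this]
    exact isClosed_Ici.inter (((Set.finite_Iic n).isClosed_biUnion fun ℓ _ =>
      s.isClosed_enabled hc _).union (isClosed_iUnion_of_finite fun e => s.isClosed_enabled hc _))
  have hb : BddBelow T := ⟨s.time, fun u hu => hu.1⟩
  obtain ⟨h1, ev, h2⟩ := hcl.csInf_mem h hb
  exact ⟨sInf T, ev, h1, h2, fun u hu hlt ev' hev =>
    absurd (csInf_le hb ⟨hu, ev', hev⟩) (not_le.2 hlt)⟩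

lemma AlgState.Consistent.advance (h : s.Consistent σ) {u : ℝ} (hu : s.time ≤ u) :
    (s.advance σ u).Consistent σ where
  rc_eq k hk := by
    change s.cfg.servedAt k = none at hk
    simp only [AlgState.advance, hk, h.rc_eq k hk]
    simp
  le_ec k hk := by
    change s.cfg.servedAt k = none at hk
    have h1 := h.le_ec k hk
    have h2 : σ.delay k u - σ.delay k s.time ≤
        ∑ j with σ.elt j = σ.elt k ∧ s.cfg.servedAt j = none, (σ.delay j u - σ.delay j s.time) :=
      Finset.single_le_sum (f := fun j => σ.delay j u - σ.delay j s.time)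
        (fun j _ => sub_nonneg.2 (σ.delay_mono j hu)) (by simp [hk])
    simp only [AlgState.advance]
    linarith

lemma AlgState.Consistent.fire (h : s.Consistent σ) (ev : Event E) :
    (s.fire σ ev).Consistent σ where
  rc_eq k hk := AlgState.fire_rc_of_unserved (h.rc_eq k) hk
  le_ec k hk := by
    change σ.delay k s.time ≤ _
    have h1 := h.le_ec k (AlgState.servedAt_none_of_fire hk)
    cases ev with
    | prefixEvent ℓ => exact h1
    | elementEvent e =>
      simp only [AlgState.fire, Function.update_apply]
      split_ifs with he
      · refine (σ.delay_before k _ ?_).le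
        by_contra! ha
        exact AlgState.fire_served ha (by simp only [he, AlgState.level]; omega) hk
      · exact h1

/-- A measure of the number of events that may still take place. -/
noncomputable def AlgState.rank [Fintype E] (σ : Input E m) (s : AlgState E n m) : ℕ :=
  (Finset.univ.filter fun k => s.cfg.servedAt k = none ∨ s.rc k ≠ 0).card +
  (Finset.univ.filter fun k => s.cfg.servedAt k = none ∧ σ.delay k s.time = 0).card +
  (Finset.univ.filter fun e => s.ec e ≠ 0).card

/-- While time passes, an element counter can leave zero only because some unserved request for it
starts to incur delay. That request drops out of the second term of the rank and so pays for the
element in the third. -/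
lemma AlgState.Consistent.rank_advance [Fintype E] (h : s.Consistent σ) {u : ℝ}
    (hu : s.time ≤ u) : (s.advance σ u).rank σ ≤ s.rank σ := by
  unfold AlgState.rank
  rw [add_assoc, add_assoc]
  refine Nat.add_le_add (Finset.card_le_card fun k => ?_) ?_
  · simp only [Finset.mem_filter, Finset.mem_univ, true_and]
    by_cases hk : s.cfg.servedAt k = none <;> simp [AlgState.advance, hk]
  set F := Finset.univ.filter fun k => s.cfg.servedAt k = none ∧ σ.delay k s.time = 0 with hF
  set F' := Finset.univ.filter fun k => (s.advance σ u).cfg.servedAt k = none ∧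
    σ.delay k (s.advance σ u).time = 0 with hF'
  set Z := Finset.univ.filter fun e => s.ec e ≠ 0 with hZ
  set Z' := Finset.univ.filter fun e => (s.advance σ u).ec e ≠ 0 with hZ'
  have hFF : F' ⊆ F := by
    intro k
    simp only [hF, hF', Finset.mem_filter, Finset.mem_univ, true_and]
    simp only [AlgState.advance]
    exact fun hk => ⟨hk.1, le_antisymm ((σ.delay_mono k hu).trans hk.2.le) (σ.delay_nonneg k _)⟩
  have hZZ : Z' ⊆ Z ∪ (F \ F').image σ.elt := by
    intro e he
    by_cases hz : s.ec e = 0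
    · simp only [hZ', Finset.mem_filter, Finset.mem_univ, true_and] at he
      simp only [AlgState.advance, hz, zero_add] at he
      obtain ⟨k, hk, hne⟩ := Finset.exists_ne_zero_of_sum_ne_zero he
      simp only [Finset.mem_filter, Finset.mem_univ, true_and] at hk
      refine Finset.mem_union_right _ (Finset.mem_image.2 ⟨k, ?_, hk.1⟩)
      have h0 : σ.delay k s.time = 0 :=
        le_antisymm ((h.le_ec k hk.2).trans (by rw [hk.1, hz])) (σ.delay_nonneg k _)
      simp only [hF, hF', Finset.mem_sdiff, Finset.mem_filter, Finset.mem_univ, true_and]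
      simp only [AlgState.advance]
      refine ⟨⟨hk.2, h0⟩, fun h' => hne ?_⟩
      rw [h'.2, h0, sub_zero]
    · exact Finset.mem_union_left _ (by simp [hZ, hz])
  have h1 := (Finset.card_le_card hZZ).trans (Finset.card_union_le _ _)
  have h2 : ((F \ F').image σ.elt).card ≤ (F \ F').card := Finset.card_image_le
  have h3 := Finset.card_sdiff_add_card_eq_card hFF
  omega

/-- A prefix event has a nonzero counter among those it deletes, and the request of that counter is
served at the latest now; an element event resets a nonzero element counter. Either way one term of
the rank drops and no term grows. -/
lemma AlgState.Consistent.rank_fire [Fintype E] (h : s.Consistent σ) {ev : Event E}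
    (hev : s.Enabled σ ev) : (s.fire σ ev).rank σ < s.rank σ := by
  unfold AlgState.rank
  have h1 : (Finset.univ.filter fun k => (s.fire σ ev).cfg.servedAt k = none ∨
      (s.fire σ ev).rc k ≠ 0) ⊆ Finset.univ.filter fun k =>
      s.cfg.servedAt k = none ∨ s.rc k ≠ 0 := by
    intro k
    simp only [Finset.mem_filter, Finset.mem_univ, true_and]
    refine Or.imp AlgState.servedAt_none_of_fire fun hk => ?_
    rcases AlgState.fire_rc_eq (σ := σ) (s := s) ev k with h' | h'
    · exact absurd h' hk
    · rwa [h'] at hk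
  have h2 : (Finset.univ.filter fun k => (s.fire σ ev).cfg.servedAt k = none ∧
      σ.delay k (s.fire σ ev).time = 0) ⊆ Finset.univ.filter fun k =>
      s.cfg.servedAt k = none ∧ σ.delay k s.time = 0 := by
    intro k
    simp only [Finset.mem_filter, Finset.mem_univ, true_and]
    exact And.imp_left AlgState.servedAt_none_of_fire
  cases ev with
  | prefixEvent ℓ =>
    refine Nat.add_lt_add_of_lt_of_le (Nat.add_lt_add_of_lt_of_le
      (Finset.card_lt_card (Finset.ssubset_iff_subset_ne.2 ⟨h1, fun heq => ?_⟩))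
      (Finset.card_le_card h2)) le_rfl
    obtain ⟨hl1, -, hsum⟩ := hev
    obtain ⟨k, hk, hne⟩ := Finset.exists_ne_zero_of_sum_ne_zero
      (hsum.trans_ne (Nat.cast_ne_zero.2 (by omega)))
    simp only [Finset.mem_filter, Finset.mem_univ, true_and] at hk
    have hmem : k ∈ Finset.univ.filter fun k => s.cfg.servedAt k = none ∨ s.rc k ≠ 0 := by
      simp [hne]
    rw [← heq] at hmem
    simp only [Finset.mem_filter, Finset.mem_univ, true_and] at hmem
    rcases hmem with h' | h'
    · refine AlgState.fire_served (σ := σ) (s := s) (ev := .prefixEvent ℓ)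
        (σ.arr_le_of_delay_ne ?_) (by simp only [AlgState.level]; omega) h'
      rwa [← h.rc_eq k (AlgState.servedAt_none_of_fire h')]
    · simp [AlgState.fire, hk] at h'
  | elementEvent e =>
    refine Nat.add_lt_add_of_le_of_lt (Nat.add_le_add (Finset.card_le_card h1)
      (Finset.card_le_card h2)) (Finset.card_lt_card (Finset.ssubset_iff_of_subset ?_ |>.2
        ⟨e, ?_, ?_⟩))
    · intro x
      simp only [Finset.mem_filter, Finset.mem_univ, true_and]
      simp only [AlgState.fire, Function.update_apply]
      split_ifs <;> simp
    · have : s.ec e ≠ 0 := by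
        rw [show s.ec e = _ from hev]
        positivity
      simpa using this
    · simp only [Finset.mem_filter, Finset.mem_univ, true_and]
      simp [AlgState.fire]

theorem AlgState.Consistent.exists_run [Fintype E] (hc : ∀ k, Continuous (σ.delay k)) :
    ∀ {s : AlgState E n m}, s.Consistent σ → ∃ acts, IsRunFrom σ s acts := by
  intro s
  induction hN : s.rank σ using Nat.strong_induction_on generalizing s with
  | _ N ih =>
    intro hs
    by_cases h : ∃ u, s.time ≤ u ∧ ∃ ev, (s.advance σ u).Enabled σ ev
    · obtain ⟨t, ev, hle, hev, hq⟩ := s.exists_first_event hc h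
      have hs' := hs.advance hle
      obtain ⟨acts, hacts⟩ := ih _
        (hN ▸ (hs'.rank_fire hev).trans_le (hs.rank_advance hle)) rfl (hs'.fire ev)
      exact ⟨_, .event s t ev acts hle hq hev hacts⟩
    · push Not at h
      exact ⟨[], .done s h⟩

end Runs

/-! ### Bounds on the counters -/

lemma le_of_forall_ne {f : ℝ → ℝ} (hf : Continuous f) {a u c : ℝ} (ha : f a ≤ c) (hau : a ≤ u)
    (hne : ∀ v, a ≤ v → v < u → f v ≠ c) : f u ≤ c := by
  by_contra! h
  obtain ⟨v, hv, hvc⟩ := intermediate_value_Icc hau hf.continuousOn ⟨ha, h.le⟩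
  refine hne v hv.1 (lt_of_le_of_ne hv.2 ?_) hvc
  rintro rfl
  exact h.ne' hvc

section Counters

/-- The counters do not exceed the thresholds at which events take place. -/
structure AlgState.Safe (σ : Input E m) (s : AlgState E n m) : Prop
    extends AlgState.Consistent σ s where
  rc_nonneg : ∀ k, 0 ≤ s.rc k
  ec_nonneg : ∀ e, 0 ≤ s.ec e
  prefix_le : ∀ ℓ : ℕ, ∑ k with (s.cfg.pos (σ.elt k)).val < ℓ, s.rc k ≤ ℓ
  ec_le : ∀ e, s.ec e ≤ (s.cfg.pos e).val + 1

variable {σ : Input E m} {s : AlgState E n m} [DecidableEq E]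

/-- By the intermediate value theorem a continuous counter cannot pass its threshold without an
event taking place. -/
lemma AlgState.Safe.advance (hc : ∀ k, Continuous (σ.delay k)) (h : s.Safe σ) {u : ℝ}
    (hu : s.time ≤ u)
    (quiet : ∀ v, s.time ≤ v → v < u → ∀ ev, ¬ (s.advance σ v).Enabled σ ev) :
    (s.advance σ u).Safe σ where
  toConsistent := h.toConsistent.advance hu
  rc_nonneg k := by
    have h1 := h.rc_nonneg k
    have h2 := σ.delay_mono k hu
    simp only [AlgState.advance]
    split_ifs <;> linarith
  ec_nonneg e := add_nonneg (h.ec_nonneg e)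
    (Finset.sum_nonneg fun k _ => sub_nonneg.2 (σ.delay_mono k hu))
  prefix_le ℓ := by
    have key : ∀ ℓ, ℓ ≤ n →
        ∑ k with (s.cfg.pos (σ.elt k)).val < ℓ, (s.advance σ u).rc k ≤ ℓ := by
      intro ℓ hn
      rcases Nat.eq_zero_or_pos ℓ with rfl | hl
      · simp
      refine le_of_forall_ne (f := fun u => ∑ k with (s.cfg.pos (σ.elt k)).val < ℓ,
        (s.advance σ u).rc k) ?_ ?_ hu fun v h1 h2 h3 => quiet v h1 h2 (.prefixEvent ℓ) ⟨hl, hn, h3⟩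
      · exact continuous_finsetSum _ fun k _ => s.continuous_rc_advance hc k
      · simp only [AlgState.advance_self]
        exact h.prefix_le ℓ
    rcases le_total ℓ n with hn | hn
    · exact key ℓ hn
    · refine le_trans ?_ ((key n le_rfl).trans (Nat.cast_le.2 hn))
      refine (Finset.sum_congr ?_ fun _ _ => rfl).le
      refine Finset.filter_congr fun k _ => ?_
      have h1 := (s.cfg.pos (σ.elt k)).isLt
      exact ⟨fun _ => h1, fun _ => h1.trans_le hn⟩
  ec_le e := by
    refine le_of_forall_ne (f := fun u => (s.advance σ u).ec e) (s.continuous_ec_advance hc e) ?_ hu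
      fun v h1 h2 h3 => quiet v h1 h2 (.elementEvent e) h3
    simp only [AlgState.advance_self]
    exact h.ec_le e

lemma AlgState.fire_pos_ge {ev : Event E} {x : E} (hx : ev ≠ .elementEvent x) :
    (s.cfg.pos x).val ≤ ((s.fire σ ev).cfg.pos x).val := by
  cases ev with
  | prefixEvent ℓ => exact le_rfl
  | elementEvent e =>
    rw [(s.fire_pos_element σ e).2 x (by rintro rfl; exact hx rfl)]
    split_ifs <;> omega

lemma AlgState.Safe.fire (h : s.Safe σ) (ev : Event E) : (s.fire σ ev).Safe σ where
  toConsistent := h.toConsistent.fire ev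
  rc_nonneg k := by
    rcases AlgState.fire_rc_eq (σ := σ) (s := s) ev k with h1 | h1 <;> rw [h1]
    exact h.rc_nonneg k
  ec_nonneg e := by
    have h1 := h.ec_nonneg e
    cases ev <;> simp only [AlgState.fire, Function.update_apply]
    · exact h1
    · split_ifs
      exacts [le_rfl, h1]
  prefix_le ℓ := by
    -- Only the element of an element event moves forward, and the counters of its requests are
    -- deleted, so no prefix sum grows.
    refine le_trans ?_ (h.prefix_le ℓ)
    rw [Finset.sum_filter, Finset.sum_filter]
    refine Finset.sum_le_sum fun k _ => ?_
    have h1 := h.rc_nonneg k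
    by_cases hx : ev = .elementEvent (σ.elt k)
    · have : (s.fire σ ev).rc k = 0 := by subst hx; exact if_pos rfl
      rw [this]
      split_ifs <;> simp [h1]
    · have h2 := AlgState.fire_pos_ge (σ := σ) (s := s) hx
      rcases AlgState.fire_rc_eq (σ := σ) (s := s) ev k with h3 | h3 <;> rw [h3] <;>
        split_ifs <;> first | exact le_rfl | exact h1 | omega
  ec_le e := by
    by_cases hx : ev = .elementEvent e
    · have : (s.fire σ ev).ec e = 0 := by
        subst hx
        exact Function.update_self ..
      rw [this]
      positivity
    · have h2 : ((s.cfg.pos e).val : ℝ) ≤ ((s.fire σ ev).cfg.pos e).val :=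
        Nat.cast_le.2 (AlgState.fire_pos_ge hx)
      have h3 : (s.fire σ ev).ec e = s.ec e := by
        cases ev with
        | prefixEvent ℓ => rfl
        | elementEvent x => exact Function.update_of_ne (by rintro rfl; exact hx rfl) _ _
      have := h.ec_le e
      linarith

/-! ### Requests that the offline solution serves at a comparable cost -/

/-- The requests in `R` are at positions in `(L / 2, L]` and keep their counters, or they are all
served and their delays beyond `b` are at most `L`. -/
def AlgState.Band (σ : Input E m) (s : AlgState E n m) (b : Fin m → ℝ) (R : Finset (Fin m))
    (L : ℕ) : Prop :=
  (∀ k ∈ R, σ.arr k ≤ s.time ∧ s.rc k = s.incurred σ k ∧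
    L / 2 < (s.cfg.pos (σ.elt k)).val + 1 ∧ (s.cfg.pos (σ.elt k)).val + 1 ≤ L) ∨
  ((∀ k ∈ R, s.cfg.servedAt k ≠ none) ∧ ∑ k ∈ R, (s.incurred σ k - b k) ≤ L)

variable {b : Fin m → ℝ} {R Q : Finset (Fin m)} {L B : ℕ}

omit [DecidableEq E] in
lemma AlgState.Safe.band_sum_le (h : s.Safe σ) (hb : ∀ k, 0 ≤ b k) (hR : s.Band σ b R L) :
    ∑ k ∈ R, (s.incurred σ k - b k) ≤ L := by
  rcases hR with hR | hR
  · refine le_trans ?_ (h.prefix_le L)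
    refine le_trans (Finset.sum_le_sum fun k hk => ?_)
      (Finset.sum_le_sum_of_subset_of_nonneg (f := s.rc) (fun k hk => ?_)
        fun k _ _ => h.rc_nonneg k)
    · rw [(hR k hk).2.1]
      linarith [hb k]
    · simp only [Finset.mem_filter, Finset.mem_univ, true_and]
      exact (hR k hk).2.2.2
  · exact hR.2

lemma AlgState.Band.advance (hR : s.Band σ b R L) {u : ℝ} (hu : s.time ≤ u) :
    (s.advance σ u).Band σ b R L := by
  refine hR.imp (fun hR k hk => ?_) fun hR => ⟨hR.1, ?_⟩
  · obtain ⟨h1, h2, h3⟩ := hR k hk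
    refine ⟨h1.trans hu, ?_, h3⟩
    rw [AlgState.incurred_advance, ← h2]
    rfl
  · refine (Finset.sum_congr rfl fun k hk => ?_).trans_le hR.2
    rw [AlgState.incurred_advance, if_neg (hR.1 k hk), add_zero]

/-- An event of level at most `L / 2` touches neither positions nor counters in the band, even if
its access serves some of the requests. A larger level makes the access reach position `L`, which
serves the whole band and freezes its delay. -/
lemma AlgState.Band.fire (hR : s.Band σ b R L) (h : s.Safe σ) (hb : ∀ k, 0 ≤ b k)
    (ev : Event E) : (s.fire σ ev).Band σ b R L := by
  have hsum := h.band_sum_le hb hR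
  simp_rw [← AlgState.incurred_fire (σ := σ) (s := s) ev] at hsum
  rcases hR with hR | hR
  · rcases le_or_gt (s.level ev) (L / 2) with hl | hl
    · left
      intro k hk
      obtain ⟨h1, h2, h3, h4⟩ := hR k hk
      have hp : s.level ev ≤ (s.cfg.pos (σ.elt k)).val := by omega
      rw [AlgState.fire_pos_eq hp, AlgState.fire_rc_of_le hp, AlgState.incurred_fire]
      exact ⟨h1, h2, h3, h4⟩
    · right
      refine ⟨fun k hk => AlgState.fire_served (hR k hk).1 ?_, hsum⟩
      have := (hR k hk).2.2.2
      omega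
  · right
    refine ⟨fun k hk h' => hR.1 k hk (AlgState.servedAt_none_of_fire h'), hsum⟩

/-- The set of requests splits into bands of total width at most `B`. -/
inductive AlgState.Banded (σ : Input E m) (s : AlgState E n m) (b : Fin m → ℝ) :
    Finset (Fin m) → ℕ → Prop
  | empty : AlgState.Banded σ s b ∅ 0
  | union {Q R : Finset (Fin m)} {B L : ℕ} (hQ : AlgState.Banded σ s b Q B)
      (hR : s.Band σ b R L) (hd : Disjoint Q R) : AlgState.Banded σ s b (Q ∪ R) (B + L)

lemma AlgState.Banded.advance (hQ : s.Banded σ b Q B) {u : ℝ} (hu : s.time ≤ u) :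
    (s.advance σ u).Banded σ b Q B := by
  induction hQ with
  | empty => exact .empty
  | union _ hR hd ih => exact .union ih (hR.advance hu) hd

lemma AlgState.Banded.fire (hQ : s.Banded σ b Q B) (h : s.Safe σ) (hb : ∀ k, 0 ≤ b k)
    (ev : Event E) : (s.fire σ ev).Banded σ b Q B := by
  induction hQ with
  | empty => exact .empty
  | union _ hR hd ih => exact .union ih (hR.fire h hb ev) hd

omit [DecidableEq E] in
lemma AlgState.Banded.sum_le (hQ : s.Banded σ b Q B) (h : s.Safe σ) (hb : ∀ k, 0 ≤ b k) :
    ∑ k ∈ Q, (s.incurred σ k - b k) ≤ B := by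
  induction hQ with
  | empty => simp
  | union _ hR hd ih =>
    rw [Finset.sum_union hd]
    push_cast
    exact add_le_add ih (h.band_sum_le hb hR)

omit [DecidableEq E] in
/-- Unserved requests at the first `L` positions split into bands of widths `L`, `L / 2`, … -/
lemma AlgState.Banded.union_of_pos_lt (h : s.Safe σ) (hQ : s.Banded σ b Q B) (L : ℕ) :
    ∀ R : Finset (Fin m), Disjoint Q R → (∀ k ∈ R, σ.arr k ≤ s.time ∧
      s.cfg.servedAt k = none ∧ (s.cfg.pos (σ.elt k)).val < L) →
    ∃ B', B' ≤ B + 2 * L ∧ s.Banded σ b (Q ∪ R) B' := by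
  induction L using Nat.strong_induction_on with
  | _ L ih =>
    intro R hd hR
    rcases Nat.eq_zero_or_pos L with rfl | hL
    · have : R = ∅ := Finset.eq_empty_of_forall_notMem fun k hk => by simpa using (hR k hk).2.2
      exact ⟨B, le_self_add, by rwa [this, Finset.union_empty]⟩
    · set R₁ := R.filter fun k => (s.cfg.pos (σ.elt k)).val < L / 2 with hR₁
      set R₂ := R.filter fun k => ¬ (s.cfg.pos (σ.elt k)).val < L / 2 with hR₂
      have hu : R₁ ∪ R₂ = R := Finset.filter_union_filter_not_eq _ _
      obtain ⟨B', hB', hQ'⟩ := ih (L / 2) (by omega) R₁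
        (hd.mono_right (Finset.filter_subset _ _)) fun k hk => by
          rw [hR₁, Finset.mem_filter] at hk
          exact ⟨(hR k hk.1).1, (hR k hk.1).2.1, hk.2⟩
      refine ⟨B' + L, by omega, ?_⟩
      rw [← hu, ← Finset.union_assoc]
      refine .union hQ' (.inl fun k hk => ?_) ?_
      · rw [hR₂, Finset.mem_filter] at hk
        obtain ⟨h1, h2, h3⟩ := hR k hk.1
        exact ⟨h1, by rw [AlgState.incurred_none h2, h.rc_eq k h2], by omega, by omega⟩
      · rw [Finset.disjoint_union_left]
        exact ⟨hd.mono_right (Finset.filter_subset _ _), Finset.disjoint_filter_filter_not _ _ _⟩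

end Counters

/-! ### The potential function argument -/

/-- Bookkeeping for the comparison with an offline solution: its current list and service times,
the requests it has served while they were far away resp. near in the list of the algorithm, the
elements with a far request since they were last moved to the front, the number of offline swaps
that moved an element back since then, the total numbers of offline swaps and accessed elements,
and the cost of the actions of the algorithm. -/
structure Ledger (E : Type*) (n m : ℕ) where
  cfg : Config E n m
  far : Finset (Fin m)
  near : Finset (Fin m)
  flag : Finset E
  back : E → ℕ
  swaps : ℕ
  access : ℕ
  paid : ℕ

section Invariant

variable [Fintype E] [DecidableEq E]

/-- The invariant that relates the state of the algorithm to the offline solution: the counters are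
safe, the ledger is accurate, and the potential pays for the delays of the algorithm. -/
structure Balanced (σ : Input E m) (b : Fin m → ℝ) (s : AlgState E n m) (g : Ledger E n m) :
    Prop where
  safe : s.Safe σ
  served_le : ∀ k t, s.cfg.servedAt k = some t → t ≤ s.time
  served_iff : ∀ k, k ∈ g.far ∨ k ∈ g.near ↔ g.cfg.servedAt k ≠ none
  disj : Disjoint g.far g.near
  far_arr : ∀ k ∈ g.far, σ.arr k ≤ s.time
  far_flag : ∀ k ∈ g.far, s.cfg.servedAt k = none → σ.elt k ∈ g.flag
  flag_pos : ∀ e ∈ g.flag, 4 * ((g.cfg.pos e).val + 1) ≤ (s.cfg.pos e).val + 1 + 4 * g.back e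
  banded : ∃ B, B ≤ 8 * g.access ∧ s.Banded σ b g.near B
  paid_le : g.paid + 2 * ∑ k, s.rc k + 3 * ∑ e, s.ec e ≤ 5 * ∑ k, s.incurred σ k
  potential : ∑ k, s.incurred σ k + 2 * (inversions s.cfg.pos g.cfg.pos : ℕ) +
      4 * (∑ e, g.back e : ℕ) + 3 * ∑ e ∈ g.flagᶜ, s.ec e ≤
    6 * g.swaps + 3 * (∑ k, if k ∈ g.far then b k else s.incurred σ k) + ∑ e, s.ec e

variable {σ : Input E m} {b : Fin m → ℝ} {s : AlgState E n m} {g : Ledger E n m}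

/-- Each unit of delay adds one to both sides of the potential inequality. It also adds three on the
left if the element is unflagged; the request is then not far, so `G` pays for these three. -/
lemma Balanced.advance (hc : ∀ k, Continuous (σ.delay k)) (h : Balanced σ b s g) {u : ℝ}
    (hu : s.time ≤ u)
    (quiet : ∀ v, s.time ≤ v → v < u → ∀ ev, ¬ (s.advance σ v).Enabled σ ev) :
    Balanced σ b (s.advance σ u) g := by
  set δ : Fin m → ℝ := fun k =>
    if s.cfg.servedAt k = none then σ.delay k u - σ.delay k s.time else 0 with hδ
  have hδ0 : ∀ k, 0 ≤ δ k := fun k => by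
    have := σ.delay_mono k hu
    simp only [hδ]
    split_ifs <;> linarith
  have hi : ∑ k, (s.advance σ u).incurred σ k = ∑ k, s.incurred σ k + ∑ k, δ k := by
    simp_rw [AlgState.incurred_advance]
    rw [Finset.sum_add_distrib]
  have hr : ∑ k, (s.advance σ u).rc k = ∑ k, s.rc k + ∑ k, δ k := by
    rw [← Finset.sum_add_distrib]
    rfl
  have he : ∑ e, (s.advance σ u).ec e = ∑ e, s.ec e + ∑ k, δ k := by
    rw [AlgState.sum_ec_advance]
    simp [hδ]
  refine ⟨h.safe.advance hc hu quiet, fun k t hk => (h.served_le k t hk).trans hu, h.served_iff,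
    h.disj, fun k hk => (h.far_arr k hk).trans hu, h.far_flag, h.flag_pos, ?_, ?_, ?_⟩
  · obtain ⟨B, hB, hQ⟩ := h.banded
    exact ⟨B, hB, hQ.advance hu⟩
  · have := h.paid_le
    rw [hi, hr, he]
    linarith
  · have hp := h.potential
    have hf : ∑ e ∈ g.flagᶜ, (s.advance σ u).ec e ≤
        ∑ e ∈ g.flagᶜ, s.ec e + ∑ k, if k ∈ g.far then 0 else δ k := by
      rw [AlgState.sum_ec_advance, Finset.sum_filter]
      refine add_le_add_right (Finset.sum_le_sum fun k _ => ?_) _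
      change (if σ.elt k ∈ g.flagᶜ then δ k else 0) ≤ _
      by_cases hk : s.cfg.servedAt k = none
      · by_cases hf : k ∈ g.far
        · simp [hf, h.far_flag k hf hk]
        · rw [if_neg hf]
          split_ifs
          exacts [le_rfl, hδ0 k]
      · simp [hδ, hk]
    have hG : (∑ k, if k ∈ g.far then b k else (s.advance σ u).incurred σ k) =
        (∑ k, if k ∈ g.far then b k else s.incurred σ k) +
          ∑ k, if k ∈ g.far then 0 else δ k := by
      rw [← Finset.sum_add_distrib]
      refine Finset.sum_congr rfl fun k _ => ?_
      rw [AlgState.incurred_advance]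
      split_ifs <;> simp_all
    rw [hi, he, hG]
    change _ + 2 * ((inversions s.cfg.pos g.cfg.pos : ℕ) : ℝ) + _ + _ ≤ _
    linarith

/-- The coefficient `6` pays `2` for a possible new inversion and `4` for the increase of `back` at
the element that moves backward. A swap without effect is still counted. -/
lemma Balanced.swap (h : Balanced σ b s g) (t : ℝ) (i : ℕ) :
    ∃ g', Balanced σ b s g' ∧ g'.cfg = g.cfg.step σ t (.swap i) ∧ g'.paid = g.paid ∧
      g'.swaps = g.swaps + 1 ∧ g'.access = g.access := by
  by_cases hi : i + 1 < n
  · set a := g.cfg.pos.symm ⟨i, by omega⟩ with ha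
    have hpa : (g.cfg.pos a).val = i := by simp [ha]
    have hpos := g.cfg.step_swap_pos σ t hi
    have hsv := g.cfg.step_swap_servedAt σ t i
    refine ⟨⟨g.cfg.step σ t (.swap i), g.far, g.near, g.flag,
      Function.update g.back a (g.back a + 1), g.swaps + 1, g.access, g.paid⟩,
      ⟨h.safe, h.served_le, fun k => by rw [hsv]; exact h.served_iff k, h.disj, h.far_arr,
        h.far_flag, fun e he => ?_, h.banded, h.paid_le, ?_⟩, rfl, rfl, rfl, rfl⟩
    · have h1 := h.flag_pos e he
      simp only [Function.update_apply]
      rw [hpos]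
      split_ifs with h2 h3 h3 h3 h3
      · subst h3; omega
      · exact absurd (g.cfg.pos.injective (Fin.ext (h2.trans hpa.symm))) h3
      · subst h3; omega
      · omega
      · subst h3; omega
      · exact h1
    · have h1 := inversions_swap s.cfg.pos hi hpos
      have h2 : ∑ e, Function.update g.back a (g.back a + 1) e = ∑ e, g.back e + 1 := by
        rw [Finset.sum_update_of_mem (Finset.mem_univ a),
          ← Finset.add_sum_erase _ g.back (Finset.mem_univ a), Finset.sdiff_singleton_eq_erase]
        ring
      have h3 := h.potential
      have h4 : ((inversions s.cfg.pos (g.cfg.step σ t (.swap i)).pos : ℕ) : ℝ) ≤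
        (inversions s.cfg.pos g.cfg.pos : ℕ) + 1 := by exact_mod_cast h1
      simp only [h2]
      push_cast at h3 ⊢
      linarith
  · refine ⟨{ g with swaps := g.swaps + 1 }, ⟨h.safe, h.served_le, h.served_iff, h.disj,
      h.far_arr, h.far_flag, h.flag_pos, h.banded, h.paid_le, ?_⟩, ?_, rfl, rfl, rfl⟩
    · refine h.potential.trans ?_
      push_cast
      linarith
    · simp [Config.step, hi]

lemma Balanced.access (h : Balanced σ b s g) (p : ℕ)
    (hb : ∀ k t, (g.cfg.step σ s.time (.access p)).servedAt k = some t → b k = σ.delay k t) :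
    ∃ g', Balanced σ b s g' ∧ g'.cfg = g.cfg.step σ s.time (.access p) ∧ g'.paid = g.paid ∧
      g'.swaps = g.swaps ∧ g'.access = g.access + p := by
  set c' := g.cfg.step σ s.time (.access p) with hc'
  set N := Finset.univ.filter fun k => g.cfg.servedAt k = none ∧ σ.arr k ≤ s.time ∧
    (g.cfg.pos (σ.elt k)).val < p with hN
  have hmemN : ∀ k, k ∈ N ↔ g.cfg.servedAt k = none ∧ σ.arr k ≤ s.time ∧
    (g.cfg.pos (σ.elt k)).val < p := fun k => by simp [hN]
  have hsv : ∀ k, c'.servedAt k = if k ∈ N then some s.time else g.cfg.servedAt k := fun k => by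
    simp only [hmemN]
    rfl
  have hold : ∀ k ∈ N, k ∉ g.far ∧ k ∉ g.near := fun k hk => by
    rw [← not_or, h.served_iff, not_not]
    exact ((hmemN k).1 hk).1
  -- `N₁` are the new near requests and `N₂` the new far ones, including those that the algorithm
  -- has already served; only the elements of the unserved ones in `N₂` get flagged.
  set N₁ := N.filter fun k => s.cfg.servedAt k = none ∧ (s.cfg.pos (σ.elt k)).val < 4 * p with hN₁
  set N₂ := N.filter fun k => ¬ (s.cfg.servedAt k = none ∧
    (s.cfg.pos (σ.elt k)).val < 4 * p) with hN₂
  set F := (N₂.filter fun k => s.cfg.servedAt k = none).image σ.elt with hF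
  have hbN : ∀ k ∈ N, s.incurred σ k ≤ b k := by
    intro k hk
    rw [hb k s.time (by rw [hsv, if_pos hk])]
    cases ht : s.cfg.servedAt k with
    | none => rw [AlgState.incurred_none ht]
    | some t =>
      rw [AlgState.incurred_some ht]
      exact σ.delay_mono k (h.served_le k t ht)
  refine ⟨⟨c', g.far ∪ N₂, g.near ∪ N₁, g.flag ∪ F, g.back, g.swaps, g.access + p, g.paid⟩,
    ⟨h.safe, h.served_le, fun k => ?_, ?_, fun k hk => ?_, fun k hk hk' => ?_, fun e he => ?_,
      ?_, h.paid_le, ?_⟩, rfl, rfl, rfl, rfl⟩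
  · rw [hsv]
    have h1 := h.served_iff k
    simp only [Finset.mem_union, hN₁, hN₂, Finset.mem_filter]
    by_cases hk : k ∈ N
    · simp only [hk, if_true, true_and]
      simp only [ne_eq, reduceCtorEq, not_false_eq_true, iff_true]
      tauto
    · simp only [hk, if_false, false_and, or_false]
      exact h1
  · rw [Finset.disjoint_union_left, Finset.disjoint_union_right, Finset.disjoint_union_right]
    refine ⟨⟨h.disj, ?_⟩, ?_, (Finset.disjoint_filter_filter_not _ _ _).symm⟩
    · exact Finset.disjoint_left.2 fun k hk hk' => (hold k (Finset.mem_filter.1 hk').1).1 hk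
    · exact Finset.disjoint_left.2 fun k hk hk' => (hold k (Finset.mem_filter.1 hk).1).2 hk'
  · rcases Finset.mem_union.1 hk with hk | hk
    · exact h.far_arr k hk
    · exact ((hmemN k).1 (Finset.mem_filter.1 hk).1).2.1
  · rcases Finset.mem_union.1 hk with hk | hk
    · exact Finset.mem_union_left _ (h.far_flag k hk hk')
    · exact Finset.mem_union_right _
        (Finset.mem_image_of_mem _ (Finset.mem_filter.2 ⟨hk, hk'⟩))
  · rcases Finset.mem_union.1 he with he | he
    · exact h.flag_pos e he
    · obtain ⟨k, hk, rfl⟩ := Finset.mem_image.1 he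
      rw [Finset.mem_filter, hN₂, Finset.mem_filter, hmemN] at hk
      obtain ⟨⟨⟨-, -, h1⟩, h2⟩, h3⟩ := hk
      have h4 : ¬ (s.cfg.pos (σ.elt k)).val < 4 * p := fun h4 => h2 ⟨h3, h4⟩
      change 4 * ((g.cfg.pos (σ.elt k)).val + 1) ≤ _
      omega
  · obtain ⟨B, hB, hQ⟩ := h.banded
    -- Bands of widths `4p`, `2p`, … have total width at most `8p`.
    obtain ⟨B', hB', hQ'⟩ := hQ.union_of_pos_lt h.safe (4 * p) N₁
      (Finset.disjoint_left.2 fun k hk hk' => (hold k (Finset.mem_filter.1 hk').1).2 hk)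
      fun k hk => by
        rw [hN₁, Finset.mem_filter, hmemN] at hk
        exact ⟨hk.1.2.1, hk.2⟩
    exact ⟨B', by simp only; omega, hQ'⟩
  · have h1 := h.potential
    have h2 : ∑ e ∈ (g.flag ∪ F)ᶜ, s.ec e ≤ ∑ e ∈ g.flagᶜ, s.ec e :=
      Finset.sum_le_sum_of_subset_of_nonneg
        (Finset.compl_subset_compl.2 Finset.subset_union_left) fun e _ _ => h.safe.ec_nonneg e
    have h3 : (∑ k, if k ∈ g.far then b k else s.incurred σ k) ≤
        ∑ k, if k ∈ g.far ∪ N₂ then b k else s.incurred σ k := by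
      refine Finset.sum_le_sum fun k _ => ?_
      simp only [Finset.mem_union]
      split_ifs with h4 h5 h5
      · exact le_rfl
      · exact absurd (.inl h4) h5
      · exact hbN k (Finset.mem_filter.1 (h5.resolve_left h4)).1
      · exact le_rfl
    change _ + 2 * ((inversions s.cfg.pos g.cfg.pos : ℕ) : ℝ) + _ + _ ≤ _
    linarith

end Invariant

/-! ### Events and the offline cost -/

section Fire

variable [Fintype E] [DecidableEq E] {σ : Input E m} {b : Fin m → ℝ} {s : AlgState E n m}
  {g : Ledger E n m}

/-- The cost of the reaction to an event. -/
def AlgState.eventCost (s : AlgState E n m) (ev : Event E) : ℕ :=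
  ((s.actions ev).map Action.cost).sum

omit [Fintype E] [DecidableEq E] in
lemma AlgState.eventCost_prefix_le (s : AlgState E n m) (ℓ : ℕ) :
    s.eventCost (.prefixEvent ℓ) ≤ 2 * ℓ := by
  simp [AlgState.eventCost, AlgState.actions, Action.cost]

omit [Fintype E] [DecidableEq E] in
lemma AlgState.eventCost_element_le (s : AlgState E n m) (e : E) :
    s.eventCost (.elementEvent e) ≤ 3 * ((s.cfg.pos e).val + 1) := by
  have h : Action.cost ∘ Action.swap = fun _ => 1 := rfl
  simp only [AlgState.eventCost, AlgState.actions, List.map_cons, List.map_map, List.sum_cons, h,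
    List.map_const', List.length_reverse, List.length_range, List.sum_replicate, Action.cost]
  have := min_le_left (2 * ((s.cfg.pos e).val + 1)) n
  simp only [smul_eq_mul, mul_one]
  omega

omit [Fintype E] in
lemma AlgState.fire_served_le (h : ∀ k t, s.cfg.servedAt k = some t → t ≤ s.time) (ev : Event E)
    (k : Fin m) (t : ℝ) (hk : (s.fire σ ev).cfg.servedAt k = some t) : t ≤ s.time := by
  rw [AlgState.fire_servedAt] at hk
  split_ifs at hk
  · exact (Option.some.inj hk).ge
  · exact h k t hk

lemma Balanced.fire_prefix (hb : ∀ k, 0 ≤ b k) (h : Balanced σ b s g) {ℓ : ℕ}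
    (hev : s.Enabled σ (.prefixEvent ℓ)) :
    Balanced σ b (s.fire σ (.prefixEvent ℓ))
      { g with paid := g.paid + s.eventCost (.prefixEvent ℓ) } := by
  refine ⟨h.safe.fire _, s.fire_served_le h.served_le _, h.served_iff, h.disj, h.far_arr,
    fun k hk hk' => h.far_flag k hk (AlgState.servedAt_none_of_fire hk'), h.flag_pos, ?_, ?_, ?_⟩
  · obtain ⟨B, hB, hQ⟩ := h.banded
    exact ⟨B, hB, hQ.fire h.safe hb _⟩
  · simp_rw [AlgState.incurred_fire]
    have h1 := h.paid_le
    have h2 : ∑ k, (s.fire σ (.prefixEvent ℓ)).rc k + ℓ = ∑ k, s.rc k := by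
      rw [← hev.2.2, Finset.sum_filter, ← Finset.sum_add_distrib]
      refine Finset.sum_congr rfl fun k _ => ?_
      simp only [AlgState.fire]
      split_ifs <;> simp
    have h3 : (s.eventCost (.prefixEvent ℓ) : ℝ) ≤ 2 * ℓ := by
      exact_mod_cast s.eventCost_prefix_le ℓ
    have h4 : (s.fire σ (.prefixEvent ℓ)).ec = s.ec := rfl
    rw [h4]
    push_cast
    linarith
  · simp_rw [AlgState.incurred_fire]
    exact h.potential

lemma Balanced.fire_element (hb : ∀ k, 0 ≤ b k) (h : Balanced σ b s g) {e : E}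
    (hev : s.Enabled σ (.elementEvent e)) :
    Balanced σ b (s.fire σ (.elementEvent e))
      { g with
        flag := g.flag.erase e
        back := Function.update g.back e 0
        paid := g.paid + s.eventCost (.elementEvent e) } := by
  obtain ⟨hp0, hp⟩ := s.fire_pos_element σ e
  have hec : s.ec e = (s.cfg.pos e).val + 1 := hev
  have hfec : ∀ x, (s.fire σ (.elementEvent e)).ec x = if x = e then 0 else s.ec x := fun x => by
    simp only [AlgState.fire, Function.update_apply]
  have hsum : ∑ x, (s.fire σ (.elementEvent e)).ec x + s.ec e = ∑ x, s.ec x := by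
    rw [← Finset.sum_erase_add _ s.ec (Finset.mem_univ e),
      ← Finset.sum_erase_add _ _ (Finset.mem_univ e), hfec, if_pos rfl, add_zero]
    congr 1
    refine Finset.sum_congr rfl fun x hx => ?_
    rw [hfec, if_neg (Finset.ne_of_mem_erase hx)]
  refine ⟨h.safe.fire _, s.fire_served_le h.served_le _, h.served_iff, h.disj, h.far_arr,
    fun k hk hk' => ?_, fun x hx => ?_, ?_, ?_, ?_⟩
  -- The flag of `e` may be removed because the access serves every far request for `e`: all of them
  -- have arrived.
  · refine Finset.mem_erase.2 ⟨?_, h.far_flag k hk (AlgState.servedAt_none_of_fire hk')⟩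
    rintro rfl
    exact AlgState.fire_served (h.far_arr k hk) (by simp only [AlgState.level]; omega) hk'
  · obtain ⟨hx1, hx2⟩ := Finset.mem_erase.1 hx
    have h1 := h.flag_pos x hx2
    have h2 : (s.cfg.pos x).val ≤ ((s.fire σ (.elementEvent e)).cfg.pos x).val :=
      AlgState.fire_pos_ge (by simp [Ne.symm hx1])
    simp only [Function.update_of_ne hx1]
    omega
  · obtain ⟨B, hB, hQ⟩ := h.banded
    exact ⟨B, hB, hQ.fire h.safe hb _⟩
  · simp_rw [AlgState.incurred_fire]
    have h1 := h.paid_le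
    have h2 : ∑ k, (s.fire σ (.elementEvent e)).rc k ≤ ∑ k, s.rc k := by
      refine Finset.sum_le_sum fun k _ => ?_
      rcases AlgState.fire_rc_eq (σ := σ) (s := s) (.elementEvent e) k with h3 | h3 <;> rw [h3]
      exact h.safe.rc_nonneg k
    have h3 : (s.eventCost (.elementEvent e) : ℝ) ≤ 3 * ((s.cfg.pos e).val + 1) := by
      exact_mod_cast s.eventCost_element_le e
    push_cast
    linarith
  · simp_rw [AlgState.incurred_fire]
    have h1 := h.potential
    have h2 := inversions_move_front g.cfg.pos hp0 hp
    have h3 := le_invAt_add s.cfg.pos g.cfg.pos e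
    have h4 : ∑ x, Function.update g.back e 0 x + g.back e = ∑ x, g.back x := by
      rw [Finset.sum_update_of_mem (Finset.mem_univ e),
        ← Finset.sum_erase_add _ g.back (Finset.mem_univ e), Finset.sdiff_singleton_eq_erase]
      ring
    have h5 : ∑ x ∈ (g.flag.erase e)ᶜ, (s.fire σ (.elementEvent e)).ec x =
        ∑ x ∈ g.flagᶜ.erase e, s.ec x := by
      rw [Finset.compl_erase, ← Finset.sum_erase_add _ _ (Finset.mem_insert_self e _), hfec,
        if_pos rfl, add_zero, Finset.erase_insert_eq_erase]
      refine Finset.sum_congr rfl fun x hx => ?_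
      rw [hfec, if_neg (Finset.ne_of_mem_erase hx)]
    have h2' : ((inversions (s.fire σ (.elementEvent e)).cfg.pos g.cfg.pos : ℕ) : ℝ) +
        2 * (invAt s.cfg.pos g.cfg.pos e : ℕ) ≤
        (inversions s.cfg.pos g.cfg.pos : ℕ) + (s.cfg.pos e).val := by exact_mod_cast h2
    have h4' : ((∑ x, Function.update g.back e 0 x : ℕ) : ℝ) + g.back e =
      (∑ x, g.back x : ℕ) := by exact_mod_cast h4
    change _ + 2 * ((inversions (s.fire σ (.elementEvent e)).cfg.pos g.cfg.pos : ℕ) : ℝ) +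
      4 * ((∑ x, Function.update g.back e 0 x : ℕ) : ℝ) +
      3 * ∑ x ∈ (g.flag.erase e)ᶜ, (s.fire σ (.elementEvent e)).ec x ≤ _
    rw [h5]
    -- Write `P` for the one-based position of `e`; the right side loses `P`. If `e` is flagged,
    -- `invAt` is at least `3P/4 - back e`, so `2·inversions + 4·Σ back` drops by at least `P`. If
    -- not, the left side gains at most `2P` from inversions and loses `3P` from the element
    -- counter.
    by_cases he : e ∈ g.flag
    · have h6 : g.flagᶜ.erase e = g.flagᶜ := Finset.erase_eq_of_notMem (by simpa using he)
      have h7 := h.flag_pos e he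
      have h7' : 4 * (((g.cfg.pos e).val : ℝ) + 1) ≤ (s.cfg.pos e).val + 1 + 4 * g.back e := by
        exact_mod_cast h7
      have h3' : ((s.cfg.pos e).val : ℝ) ≤ (invAt s.cfg.pos g.cfg.pos e : ℕ) +
        (g.cfg.pos e).val := by exact_mod_cast h3
      rw [h6]
      linarith
    · have h6 := Finset.sum_erase_add (f := s.ec) g.flagᶜ (a := e) (by simpa using he)
      have h8 : (0 : ℝ) ≤ (invAt s.cfg.pos g.cfg.pos e : ℕ) := Nat.cast_nonneg _
      have h9 : (0 : ℝ) ≤ g.back e := Nat.cast_nonneg _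
      linarith

lemma Balanced.fire (hb : ∀ k, 0 ≤ b k) (h : Balanced σ b s g) {ev : Event E}
    (hev : s.Enabled σ ev) : ∃ g', Balanced σ b (s.fire σ ev) g' ∧ g'.cfg = g.cfg ∧
      g'.swaps = g.swaps ∧ g'.access = g.access ∧ g'.paid = g.paid + s.eventCost ev := by
  cases ev with
  | prefixEvent ℓ => exact ⟨_, h.fire_prefix hb hev, rfl, rfl, rfl, rfl⟩
  | elementEvent e => exact ⟨_, h.fire_element hb hev, rfl, rfl, rfl, rfl⟩

/-- The total delay of the algorithm is bounded by the offline cost so far. -/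
lemma Balanced.incurred_le (hb : ∀ k, 0 ≤ b k) (h : Balanced σ b s g) :
    ∑ k, s.incurred σ k ≤ 6 * g.swaps + 24 * g.access +
      3 * ∑ k, if g.cfg.servedAt k = none then s.incurred σ k else b k := by
  have hG : (∑ k, if k ∈ g.far then b k else s.incurred σ k) =
      (∑ k, if g.cfg.servedAt k = none then s.incurred σ k else b k) +
        ∑ k ∈ g.near, (s.incurred σ k - b k) := by
    rw [← Finset.univ_inter g.near, ← Finset.sum_ite_mem, ← Finset.sum_add_distrib]
    refine Finset.sum_congr rfl fun k _ => ?_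
    have h1 := h.served_iff k
    by_cases hf : k ∈ g.far
    · have hn : k ∉ g.near := Finset.disjoint_left.1 h.disj hf
      rw [if_pos hf, if_neg hn, if_neg (h1.1 (.inl hf)), add_zero]
    · by_cases hn : k ∈ g.near
      · rw [if_neg hf, if_pos hn, if_neg (h1.1 (.inr hn))]
        ring
      · have h2 : g.cfg.servedAt k = none := by
          by_contra h2
          exact (h1.2 h2).elim hf hn
        rw [if_neg hf, if_neg hn, if_pos h2, add_zero]
  obtain ⟨B, hB, hQ⟩ := h.banded
  have hN := hQ.sum_le h.safe hb
  have hB' : (B : ℝ) ≤ 8 * g.access := by exact_mod_cast hB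
  -- The counter of a flagged element is at most its position, and three quarters of that are
  -- covered by its inversions and `back`.
  have hF : ∑ e ∈ g.flag, s.ec e ≤ 2 * (inversions s.cfg.pos g.cfg.pos : ℕ) +
      4 * (∑ e, g.back e : ℕ) := by
    unfold inversions
    push_cast
    rw [Finset.mul_sum, Finset.mul_sum, ← Finset.sum_add_distrib]
    refine (Finset.sum_le_sum fun e he => ?_).trans (Finset.sum_le_sum_of_subset_of_nonneg
      (Finset.subset_univ g.flag) fun e _ _ => by positivity)
    have h1 := h.safe.ec_le e
    have h2 : 4 * (((g.cfg.pos e).val : ℝ) + 1) ≤ (s.cfg.pos e).val + 1 + 4 * g.back e := by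
      exact_mod_cast h.flag_pos e he
    have h3 : ((s.cfg.pos e).val : ℝ) ≤ (invAt s.cfg.pos g.cfg.pos e : ℕ) +
      (g.cfg.pos e).val := by exact_mod_cast le_invAt_add s.cfg.pos g.cfg.pos e
    linarith
  have hC : 0 ≤ ∑ e ∈ g.flagᶜ, s.ec e := Finset.sum_nonneg fun e _ => h.safe.ec_nonneg e
  have hS := Finset.sum_add_sum_compl g.flag s.ec
  have hP := h.potential
  linarith

end Fire

/-! ### Comparison of a run with an offline solution -/

section Comparison

variable [Fintype E] [DecidableEq E]

/-- The offline solution with remaining actions `rest`, final configuration `fc` and total cost `C`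
of its actions, next to the state of the algorithm. -/
structure Simulates (σ : Input E m) (b : Fin m → ℝ) (fc : Config E n m) (C : ℕ)
    (s : AlgState E n m) (g : Ledger E n m) (rest : List (ℝ × Action)) : Prop where
  balanced : Balanced σ b s g
  sorted : rest.Pairwise fun a b => a.1 ≤ b.1
  time_le : ∀ a ∈ rest, s.time ≤ a.1
  final : rest.foldl (fun c a => c.step σ a.1 a.2) g.cfg = fc
  total : g.swaps + g.access + (rest.map fun a => a.2.cost).sum = C

variable {σ : Input E m} {b : Fin m → ℝ} {fc : Config E n m} {C : ℕ} {s : AlgState E n m}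
  {g : Ledger E n m} {rest : List (ℝ × Action)}

omit [Fintype E] [DecidableEq E] in
lemma Config.step_servedAt_some {c : Config E n m} {t t' : ℝ} {a : Action} {k : Fin m}
    (h : c.servedAt k = some t') : (c.step σ t a).servedAt k = some t' := by
  cases a with
  | access p => simp [Config.step, h]
  | swap i => rwa [Config.step_swap_servedAt]

omit [Fintype E] [DecidableEq E] in
lemma Config.foldl_servedAt_some {k : Fin m} {t' : ℝ} (rest : List (ℝ × Action)) :
    ∀ {c : Config E n m}, c.servedAt k = some t' →
    (rest.foldl (fun c a => c.step σ a.1 a.2) c).servedAt k = some t' := by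
  induction rest with
  | nil => exact id
  | cons a l ih => exact fun h => ih (Config.step_servedAt_some h)

omit [Fintype E] [DecidableEq E] in
lemma Config.le_of_foldl_servedAt {k : Fin m} {t u : ℝ} (rest : List (ℝ × Action)) :
    ∀ {c : Config E n m}, (∀ a ∈ rest, u ≤ a.1) → c.servedAt k = none →
    (rest.foldl (fun c a => c.step σ a.1 a.2) c).servedAt k = some t → u ≤ t := by
  induction rest with
  | nil => intro c _ h h'; simp [h] at h'
  | cons a l ih =>
    intro c hl hc h
    rw [List.foldl_cons] at h
    cases hs : (c.step σ a.1 a.2).servedAt k with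
    | none => exact ih (fun x hx => hl x (List.mem_cons_of_mem _ hx)) hs h
    | some t' =>
      rw [Config.foldl_servedAt_some l hs] at h
      obtain rfl := Option.some.inj h
      obtain ⟨v, a⟩ := a
      cases a with
      | access p =>
        simp only [Config.step] at hs
        split_ifs at hs
        · exact Option.some.inj hs ▸ hl _ List.mem_cons_self
        · simp [hc] at hs
      | swap i =>
        rw [Config.step_swap_servedAt, hc] at hs
        cases hs

lemma Balanced.offline (h : Balanced σ b s g) (a : Action)
    (hb : ∀ k t, (g.cfg.step σ s.time a).servedAt k = some t → b k = σ.delay k t) :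
    ∃ g', Balanced σ b s g' ∧ g'.cfg = g.cfg.step σ s.time a ∧ g'.paid = g.paid ∧
      g'.swaps + g'.access = g.swaps + g.access + a.cost := by
  cases a with
  | access p =>
    obtain ⟨g', h1, h2, h3, h4, h5⟩ := h.access p hb
    exact ⟨g', h1, h2, h3, by rw [h4, h5, Action.cost]; ring⟩
  | swap i =>
    obtain ⟨g', h1, h2, h3, h4, h5⟩ := h.swap s.time i
    exact ⟨g', h1, h2, h3, by rw [h4, h5, Action.cost]; ring⟩

/-- While the algorithm waits, the offline solution performs its actions. -/
lemma Simulates.advance (hc : ∀ k, Continuous (σ.delay k))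
    (hfc : ∀ k t, fc.servedAt k = some t → b k = σ.delay k t) {t : ℝ}
    (rest : List (ℝ × Action)) : ∀ {s : AlgState E n m} {g : Ledger E n m},
    Simulates σ b fc C s g rest → s.time ≤ t →
    (∀ v, s.time ≤ v → v < t → ∀ ev, ¬ (s.advance σ v).Enabled σ ev) →
    ∃ g' rest', Simulates σ b fc C (s.advance σ t) g' rest' ∧ g'.paid = g.paid := by
  induction rest with
  | nil =>
    intro s g h ht quiet
    exact ⟨g, [], ⟨h.balanced.advance hc ht quiet, h.sorted, by simp, h.final, h.total⟩, rfl⟩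
  | cons a l ih =>
    intro s g h ht quiet
    -- Offline actions at time `t` itself are left until after the event of the algorithm.
    rcases le_or_gt t a.1 with hta | hta
    · refine ⟨g, a :: l, ⟨h.balanced.advance hc ht quiet, h.sorted, ?_, h.final, h.total⟩, rfl⟩
      intro x hx
      rcases List.mem_cons.1 hx with rfl | hx
      · exact hta
      · exact hta.trans ((List.pairwise_cons.1 h.sorted).1 x hx)
    · have hsa := h.time_le a List.mem_cons_self
      have h1 := h.balanced.advance hc hsa fun v hv hva => quiet v hv (hva.trans hta)
      have hfin := h.final
      rw [List.foldl_cons] at hfin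
      obtain ⟨g₁, h2, h3, h4, h5⟩ := h1.offline a.2 fun k u hk =>
        hfc k u (hfin ▸ Config.foldl_servedAt_some l hk)
      have h6 : Simulates σ b fc C (s.advance σ a.1) g₁ l := by
        refine ⟨h2, (List.pairwise_cons.1 h.sorted).2, (List.pairwise_cons.1 h.sorted).1, ?_, ?_⟩
        · rw [h3]
          exact hfin
        · rw [h5, ← h.total, List.map_cons, List.sum_cons, add_assoc]
      obtain ⟨g', rest', h7, h8⟩ := ih h6 hta.le fun v hv hvt ev => by
        rw [AlgState.advance_advance]
        exact quiet v (hsa.trans hv) hvt ev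
      rw [AlgState.advance_advance] at h7
      exact ⟨g', rest', h7, h8.trans h4⟩

lemma Simulates.fire (hb : ∀ k, 0 ≤ b k) (h : Simulates σ b fc C s g rest) {ev : Event E}
    (hev : s.Enabled σ ev) : ∃ g', Simulates σ b fc C (s.fire σ ev) g' rest ∧
      g'.paid = g.paid + s.eventCost ev := by
  obtain ⟨g', h1, h2, h3, h4, h5⟩ := h.balanced.fire hb hev
  exact ⟨g', ⟨h1, h.sorted, h.time_le, by rw [h2]; exact h.final, by rw [h3, h4]; exact h.total⟩, h5⟩

/-- The cost of the algorithm up to now is bounded by the offline cost. -/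
lemma Simulates.paid_add_le (hb : ∀ k, 0 ≤ b k)
    (hfc : ∀ k t, fc.servedAt k = some t → b k = σ.delay k t)
    (h : Simulates σ b fc C s g rest) :
    (g.paid : ℝ≥0∞) + ∑ k, ENNReal.ofReal (s.incurred σ k) ≤
      144 * (C + ∑ k, σ.delayCost k (fc.servedAt k)) := by
  have hi0 : ∀ k, 0 ≤ s.incurred σ k := fun k => by
    unfold AlgState.incurred
    split <;> exact σ.delay_nonneg _ _
  -- A request that is still open offline will be served there no earlier than now, or never, so the
  -- delay that the algorithm has incurred for it is covered by its final offline delay.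
  set x : Fin m → ℝ := fun k => if g.cfg.servedAt k = none then s.incurred σ k else b k with hx
  have hx0 : ∀ k, 0 ≤ x k := fun k => by
    simp only [hx]
    split_ifs
    exacts [hi0 k, hb k]
  have hxle : ∀ k, ENNReal.ofReal (x k) ≤ σ.delayCost k (fc.servedAt k) := by
    intro k
    have hf := h.final
    by_cases hk : g.cfg.servedAt k = none
    · have hiu : s.incurred σ k ≤ σ.delay k s.time := by
        cases ht : s.cfg.servedAt k with
        | none => rw [AlgState.incurred_none ht]
        | some t =>
          rw [AlgState.incurred_some ht]
          exact σ.delay_mono k (h.balanced.served_le k t ht)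
      simp only [hx, hk, if_true]
      cases ht : fc.servedAt k with
      | none => exact le_iSup_of_le s.time (ENNReal.ofReal_le_ofReal hiu)
      | some t =>
        rw [← hf] at ht
        exact ENNReal.ofReal_le_ofReal (hiu.trans
          (σ.delay_mono k (Config.le_of_foldl_servedAt rest h.time_le hk ht)))
    · obtain ⟨t, ht⟩ := Option.ne_none_iff_exists'.1 hk
      have ht' := Config.foldl_servedAt_some (σ := σ) rest ht
      rw [hf] at ht'
      simp only [hx, hk, if_false]
      rw [ht', hfc k t ht']
      rfl
  have h1 := h.balanced.incurred_le hb
  have h2 := h.balanced.paid_le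
  have h3 : 0 ≤ ∑ k, s.rc k := Finset.sum_nonneg fun k _ => h.balanced.safe.rc_nonneg k
  have h4 : 0 ≤ ∑ e, s.ec e := Finset.sum_nonneg fun e _ => h.balanced.safe.ec_nonneg e
  have h5 : (g.swaps : ℝ) + g.access ≤ C := by
    rw [← h.total]
    exact_mod_cast Nat.le_add_right _ _
  have h6 : (0 : ℝ) ≤ g.swaps := Nat.cast_nonneg _
  have h7 : 0 ≤ ∑ k, x k := Finset.sum_nonneg fun k _ => hx0 k
  -- The factor is `6 · 24`: the cost so far is at most six times the delay, and `24` is the largest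
  -- coefficient in the bound on the delay.
  have key : (g.paid : ℝ) + ∑ k, s.incurred σ k ≤ 144 * (C + ∑ k, x k) := by linarith
  calc (g.paid : ℝ≥0∞) + ∑ k, ENNReal.ofReal (s.incurred σ k)
      = ENNReal.ofReal (g.paid + ∑ k, s.incurred σ k) := by
        rw [ENNReal.ofReal_add (Nat.cast_nonneg _) (Finset.sum_nonneg fun k _ => hi0 k),
          ENNReal.ofReal_natCast, ENNReal.ofReal_sum_of_nonneg fun k _ => hi0 k]
    _ ≤ ENNReal.ofReal (144 * (C + ∑ k, x k)) := ENNReal.ofReal_le_ofReal key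
    _ = 144 * (C + ∑ k, ENNReal.ofReal (x k)) := by
        rw [ENNReal.ofReal_mul (by norm_num), ENNReal.ofReal_add (Nat.cast_nonneg _) h7,
          ENNReal.ofReal_natCast, ENNReal.ofReal_sum_of_nonneg fun k _ => hx0 k,
          ENNReal.ofReal_ofNat]
    _ ≤ _ := by
        gcongr with k
        exact hxle k

theorem Simulates.cost_le (hc : ∀ k, Continuous (σ.delay k)) (hb : ∀ k, 0 ≤ b k)
    (hfc : ∀ k t, fc.servedAt k = some t → b k = σ.delay k t) {acts : List (ℝ × Action)}
    (hrun : IsRunFrom σ s acts) : ∀ {g : Ledger E n m} {rest : List (ℝ × Action)},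
    Simulates σ b fc C s g rest →
    ((g.paid + (acts.map fun a => a.2.cost).sum : ℕ) : ℝ≥0∞) +
      ∑ k, σ.delayCost k ((acts.foldl (fun c a => c.step σ a.1 a.2) s.cfg).servedAt k) ≤
      144 * (C + ∑ k, σ.delayCost k (fc.servedAt k)) := by
  induction hrun with
  | done s quiet =>
    intro g rest h
    have hmono : ∀ k, Monotone fun u => ENNReal.ofReal ((s.advance σ u).incurred σ k) := by
      intro k u v huv
      refine ENNReal.ofReal_le_ofReal ?_
      have := σ.delay_mono k huv
      simp only [AlgState.incurred_advance]
      split_ifs <;> linarith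
    have hsup : ∀ k, σ.delayCost k (s.cfg.servedAt k) =
        ⨆ u, ENNReal.ofReal ((s.advance σ u).incurred σ k) := by
      intro k
      cases hk : s.cfg.servedAt k with
      | none =>
        refine iSup_congr fun u => ?_
        rw [AlgState.incurred_none (s := s.advance σ u) hk]
        rfl
      | some t =>
        refine (ciSup_const (ι := ℝ)).symm.trans (iSup_congr fun u => ?_)
        rw [AlgState.incurred_some (s := s.advance σ u) hk]
        rfl
    simp only [List.map_nil, List.sum_nil, add_zero, List.foldl_nil, hsup]
    -- Delays of requests that are never served are suprema over time. By monotonicity the supremum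
    -- can be taken outside the sum, and the bound is proved at each finite time.
    rw [ENNReal.finsetSum_iSup_of_monotone hmono, ENNReal.add_iSup]
    refine iSup_le fun u => ?_
    refine (add_le_add le_rfl (Finset.sum_le_sum fun k _ =>
      hmono k (le_max_left u s.time))).trans ?_
    obtain ⟨g', rest', h1, h2⟩ := h.advance hc hfc _ (le_max_right u s.time) fun v hv _ =>
      quiet v hv
    rw [← h2]
    exact h1.paid_add_le hb hfc
  | event s t ev acts le quiet enabled run ih =>
    intro g rest h
    obtain ⟨g₁, rest₁, h1, h2⟩ := h.advance hc hfc _ le quiet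
    obtain ⟨g₂, h3, h4⟩ := h1.fire hb enabled
    have h5 := ih h3
    have hcost : g.paid + (((((s.advance σ t).actions ev).map fun a => (t, a)) ++ acts).map
        fun a => a.2.cost).sum = g₂.paid + (acts.map fun a => a.2.cost).sum := by
      rw [h4, h2, List.map_append, List.sum_append, List.map_map, AlgState.eventCost]
      simp only [Function.comp_def]
      ring
    have hcfg : ((((s.advance σ t).actions ev).map fun a => (t, a)) ++ acts).foldl
        (fun c a => c.step σ a.1 a.2) s.cfg = acts.foldl (fun c a => c.step σ a.1 a.2)
          ((s.advance σ t).fire σ ev).cfg := by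
      rw [List.foldl_append, List.foldl_map]
      rfl
    rw [hcost, hcfg]
    exact h5

omit [Fintype E] in
/-- The algorithm may be started earlier. -/
lemma IsRun.init_earlier (hc : ∀ k, Continuous (σ.delay k)) {l₀ : E ≃ Fin n}
    {acts : List (ℝ × Action)} (h : IsRun σ l₀ acts) {t₀ : ℝ} (ht : t₀ ≤ 0) :
    IsRunFrom σ { (AlgState.init l₀ : AlgState E n m) with time := t₀ } acts := by
  set s₀ : AlgState E n m := { (AlgState.init l₀ : AlgState E n m) with time := t₀ } with hs₀
  have hadv : ∀ u, s₀.advance σ u = (AlgState.init l₀).advance σ u := by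
    intro u
    have h0 : ∀ k, σ.delay k t₀ = σ.delay k 0 := fun k => by
      rw [σ.delay_of_le_arr hc (σ.arr_nonneg k),
        σ.delay_of_le_arr hc (ht.trans (σ.arr_nonneg k))]
    simp only [AlgState.advance, hs₀, AlgState.init, h0]
  have hquiet : ∀ u < 0, ∀ ev, ¬ (s₀.advance σ u).Enabled σ ev := by
    intro u hu ev hev
    have h0 : ∀ k, ∀ v ≤ (0 : ℝ), σ.delay k v = 0 := fun k v hv =>
      σ.delay_of_le_arr hc (hv.trans (σ.arr_nonneg k))
    cases ev with
    | prefixEvent ℓ =>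
      obtain ⟨h1, -, h2⟩ := hev
      rw [Finset.sum_eq_zero] at h2
      · have : ℓ = 0 := by exact_mod_cast h2.symm
        omega
      · intro k _
        simp [AlgState.advance, hs₀, AlgState.init, h0 k u hu.le, h0 k t₀ ht]
    | elementEvent e =>
      have h2 : (s₀.advance σ u).ec e = 0 := by
        simp only [AlgState.advance, hs₀, AlgState.init, zero_add]
        exact Finset.sum_eq_zero fun k _ => by rw [h0 k u hu.le, h0 k t₀ ht, sub_zero]
      have h3 : (s₀.advance σ u).ec e = _ := hev
      rw [h2] at h3
      exact absurd h3 (by positivity)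
  unfold IsRun at h
  have ht0 : (AlgState.init l₀ : AlgState E n m).time = 0 := rfl
  have hst : s₀.time ≤ 0 := ht
  generalize (AlgState.init l₀ : AlgState E n m) = i at h hadv ht0
  cases h with
  | done _ quiet =>
    refine .done _ fun u _ ev => ?_
    rcases lt_or_ge u 0 with hu | hu
    · exact hquiet u hu ev
    · rw [hadv]
      exact quiet u (ht0.trans_le hu) ev
  | event _ t ev rest le quiet enabled run =>
    rw [← hadv] at enabled run ⊢
    refine .event _ t ev rest (hst.trans (ht0 ▸ le)) (fun u _ hut ev' => ?_) enabled run
    rcases lt_or_ge u 0 with hu | hu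
    · exact hquiet u hu ev'
    · rw [hadv]
      exact quiet u (ht0.trans_le hu) hut ev'

lemma Balanced.init (hc : ∀ k, Continuous (σ.delay k)) (b : Fin m → ℝ) (l₀ : E ≃ Fin n) {t₀ : ℝ}
    (ht : t₀ ≤ 0) : Balanced σ b { (AlgState.init l₀ : AlgState E n m) with time := t₀ }
      ⟨⟨l₀, fun _ => none⟩, ∅, ∅, ∅, fun _ => 0, 0, 0, 0⟩ := by
  have h0 : ∀ k, σ.delay k t₀ = 0 := fun k => σ.delay_of_le_arr hc (ht.trans (σ.arr_nonneg k))
  refine ⟨⟨⟨?_, ?_⟩, ?_, ?_, ?_, ?_⟩, ?_, ?_, ?_, ?_, ?_, ?_, ⟨0, le_rfl, .empty⟩, ?_, ?_⟩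
  · exact fun k _ => (h0 k).symm
  · exact fun k _ => (h0 k).le
  · exact fun _ => le_rfl
  · exact fun _ => le_rfl
  · intro ℓ
    simp [AlgState.init]
  · intro e
    simp only [AlgState.init]
    positivity
  · intro k t h
    cases h
  · simp
  · simp
  · simp
  · simp
  · simp
  · simp [AlgState.init, AlgState.incurred, h0]
  · simp [AlgState.init, AlgState.incurred, h0, inversions_self]

/-- The cost of every run is at most `144` times the cost of every offline solution. -/
theorem IsRun.cost_le (hc : ∀ k, Continuous (σ.delay k)) {l₀ : E ≃ Fin n}
    {acts off : List (ℝ × Action)} (h : IsRun σ l₀ acts)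
    (hoff : off.Pairwise fun a b => a.1 ≤ b.1) : cost σ l₀ acts ≤ 144 * cost σ l₀ off := by
  -- A schedule carried over to a traversal may act at negative times, so the comparison starts
  -- before its first action.
  obtain ⟨t₀, ht₀, hle⟩ : ∃ t₀ ≤ (0 : ℝ), ∀ a ∈ off, t₀ ≤ a.1 := by
    cases off with
    | nil => exact ⟨0, le_rfl, by simp⟩
    | cons a l =>
      refine ⟨min 0 a.1, min_le_left _ _, fun x hx => (min_le_right _ _).trans ?_⟩
      rcases List.mem_cons.1 hx with rfl | hx
      · exact le_rfl
      · exact (List.pairwise_cons.1 hoff).1 x hx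
  -- The value `0` for requests never served offline is a mere default: these never become far or
  -- near.
  set b : Fin m → ℝ := fun k => ((exec σ l₀ off).servedAt k).elim 0 (σ.delay k) with hb
  have hsim : Simulates σ b (exec σ l₀ off) (off.map fun a => a.2.cost).sum
      { (AlgState.init l₀ : AlgState E n m) with time := t₀ }
      ⟨⟨l₀, fun _ => none⟩, ∅, ∅, ∅, fun _ => 0, 0, 0, 0⟩ off :=
    ⟨.init hc b l₀ ht₀, hoff, hle, rfl, by simp⟩
  have := hsim.cost_le hc (fun k => ?_) (fun k t hk => ?_) (h.init_earlier hc ht₀)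
  · simp only [zero_add] at this
    exact this
  · simp only [hb]
    cases (exec σ l₀ off).servedAt k with
    | none => exact le_rfl
    | some t => exact σ.delay_nonneg k t
  · simp [hb, hk]

end Comparison

end ListUpdate

theorem mainTheorem2 {E : Type*} [DecidableEq E] {n m : ℕ} (l₀ : E ≃ Fin n)
    (σ : ListUpdate.Input E m) :
    (∃ σ' : ListUpdate.Input E m, σ'.Traverses σ) ∧
    ∀ σ' : ListUpdate.Input E m, σ'.Traverses σ →
      (∃ acts, ListUpdate.IsRun σ' l₀ acts) ∧
      ∀ acts, ListUpdate.IsRun σ' l₀ acts →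
        ListUpdate.cost σ' l₀ acts ≤ 336 * ListUpdate.opt σ l₀ := by
  have : Fintype E := Fintype.ofEquiv _ l₀.symm
  refine ⟨σ.exists_traverses, fun σ' h => ?_⟩
  have hc : ∀ k, Continuous (σ'.delay k) := by
    obtain ⟨_, -, -, hk⟩ := h
    exact fun k => (hk k).2.2.2.1
  refine ⟨(ListUpdate.AlgState.Consistent.init hc l₀).exists_run hc, fun acts hrun => ?_⟩
  unfold ListUpdate.opt
  rw [ENNReal.mul_iInf_of_ne (by norm_num) (by norm_num)]
  refine le_iInf fun off => ?_
  rw [ENNReal.mul_iInf_of_ne (by norm_num) (by norm_num)]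
  refine le_iInf fun hoff => ?_
  obtain ⟨off', hsorted, hle⟩ := h.exists_schedule l₀ hoff
  refine (hrun.cost_le hc hsorted).trans ?_
  gcongr
  norm_num
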